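/- Let $\mathcal{A}$ be a (not necessarily unital) $C^*$-algebra, let $\mathcal{M}\subseteq\mathcal{B}(\mathcal{H})$ be a von Neumann algebra on a complex Hilbert space $\mathcal{H}$ with commutant $\mathcal{M}'$, and let $\varphi:\mathcal{A}\to\mathcal{M}$ be a bounded representation, i.e. a bounded complex-linear multiplicative map (not assumed unital or $*$-preserving). Write $CP(\mathcal{A},\mathcal{M})$ for the set of completely positive linear maps $\mathcal{A}\to\mathcal{M}$, and let $\mathcal{A}\otimes_{\max}\mathcal{M}'$ be the completion of the algebraic tensor product $\mathcal{A}\odot\mathcal{M}'$ in its largest $C^*$-seminorm. Then the following are equivalent: 1. $\varphi$ is similar in $\mathcal{M}$ to a $*$-representation: there is an invertible $S\in\mathcal{M}$ such that $a\mapsto S\varphi(a)S^{-1}$ is a $*$-homomorphism $\mathcal{A}\to\mathcal{M}$. 2. The map $\Phi\bigl(\sum_{i=1}^n a_i\otimes x_i\bigr)=\sum_{i=1}^n\varphi(a_i)x_i$ ($a_i\in\mathcal{A}$, $x_i\in\mathcal{M}'$) extends to a completely bounded representation (multiplicative linear map) $\Phi:\mathcal{A}\otimes_{\max}\mathcal{M}'\to\mathcal{B}(\mathcal{H})$.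 3. $\varphi=\varphi_1-\varphi_2+i(\varphi_3-\varphi_4)$ for some $\varphi_1,\varphi_2,\varphi_3,\varphi_4\in CP(\mathcal{A},\mathcal{M})$. 4. There exist $\phi_1,\phi_2\in CP(\mathcal{A},\mathcal{M})$ such that $\Psi:\mathcal{A}\to M_2(\mathcal{M})$, $\Psi(a)=\begin{pmatrix}\phi_1(a)&\varphi(a^*)^*\\ \varphi(a)&\phi_2(a)\end{pmatrix}$, is completely positive. 5. There exist $\psi\in CP(\mathcal{A},\mathcal{M})$ and $T,S\in\mathcal{M}$ such that $\varphi(a)=T^*\psi(a)S$ for all $a\in\mathcal{A}$. 6. There exist finitely many $\psi_1,\dots,\psi_n\in CP(\mathcal{A},\mathcal{M})$ and $T_i,S_i\in\mathcal{M}$ such that $\varphi(a)=\sum_{i=1}^n T_i^*\psi_i(a)S_i$ for all $a\in\mathcal{A}$. 7. There exist finitely many $*$-representations ($*$-homomorphisms) $\pi_1,\dots,\pi_n:\mathcal{A}\to\mathcal{M}$, positive invertible operators $T_1,\dots,T_n\in\mathcal{M}$, and $\alpha_1,\dots,\alpha_n>0$ with $\sum_{i=1}^n\alpha_i=1$ such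 that $\varphi(a)=\sum_{i=1}^n\alpha_iT_i\pi_i(a)T_i^{-1}$ for all $a\in\mathcal{A}$. -/

import Mathlib

open scoped TensorProduct CStarAlgebra

noncomputable section

/-! ### C⋆-seminorms and the associated C⋆-algebra -/

/-- A C⋆-seminorm on a complex ⋆-algebra `D`: a submultiplicative seminorm satisfying the
C⋆-identity. -/
structure CStarSeminorm (D : Type*) [NonUnitalRing D] [StarRing D] [Module ℂ D] extends
    Seminorm ℂ D where
  mul_le' : ∀ x y : D, toFun (x * y) ≤ toFun x * toFun y
  star_mul_self' : ∀ x : D, toFun (star x * x) = toFun x * toFun x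

namespace CStarSeminorm

section Basic

variable {D : Type*} [NonUnitalRing D] [StarRing D] [Module ℂ D]

instance : CoeFun (CStarSeminorm D) fun _ => D → ℝ := ⟨fun p => p.toSeminorm⟩

theorem mul_le (p : CStarSeminorm D) (x y : D) : p (x * y) ≤ p x * p y := p.mul_le' x y

theorem star_mul_self (p : CStarSeminorm D) (x : D) : p (star x * x) = p x * p x :=
  p.star_mul_self' x

theorem nonneg (p : CStarSeminorm D) (x : D) : 0 ≤ p x := apply_nonneg p.toSeminorm x

theorem le_star (p : CStarSeminorm D) (x : D) : p x ≤ p (star x) := by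
  rcases (p.nonneg x).eq_or_lt with h | h
  · rw [← h]; exact p.nonneg _
  · have h1 := p.mul_le (star x) x
    rw [p.star_mul_self] at h1
    exact le_of_mul_le_mul_right h1 h

theorem map_star (p : CStarSeminorm D) (x : D) : p (star x) = p x := by
  refine le_antisymm ?_ (p.le_star x)
  simpa using p.le_star (star x)

/-- The zero C⋆-seminorm. -/
instance : Inhabited (CStarSeminorm D) :=
  ⟨{ (0 : Seminorm ℂ D) with
      mul_le' := fun _ _ => (mul_zero (0 : ℝ)).ge
      star_mul_self' := fun _ => (mul_zero (0 : ℝ)).symm }⟩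

/-- The algebra `D`, equipped with the topology of the C⋆-seminorm `p`. -/
def Pre (_p : CStarSeminorm D) : Type _ := D

variable (p : CStarSeminorm D)

instance : NonUnitalRing p.Pre := inferInstanceAs (NonUnitalRing D)
instance : StarRing p.Pre := inferInstanceAs (StarRing D)
instance : Module ℂ p.Pre := inferInstanceAs (Module ℂ D)

instance : SeminormedAddCommGroup p.Pre :=
  fast_instance%
    { AddGroupSeminorm.toSeminormedAddCommGroup (E := D) p.toSeminorm.toAddGroupSeminorm with
      toAddCommGroup := inferInstanceAs (AddCommGroup p.Pre) }

/-- The identity map from `D` to `p.Pre`. -/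
def toPre (x : D) : p.Pre := x

theorem norm_toPre (x : D) : ‖p.toPre x‖ = p x := rfl

instance : NormedSpace ℂ p.Pre where
  norm_smul_le c x := (map_smul_eq_mul p.toSeminorm c x).le

theorem Pre.norm_mul_le (x y : p.Pre) : ‖x * y‖ ≤ ‖x‖ * ‖y‖ := p.mul_le x y
theorem Pre.norm_star (x : p.Pre) : ‖star x‖ = ‖x‖ := p.map_star x
theorem Pre.norm_star_mul_self (x : p.Pre) : ‖star x * x‖ = ‖x‖ * ‖x‖ := p.star_mul_self x

/-- The Hausdorff completion of `D` with respect to the C⋆-seminorm `p`. -/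
def Compl : Type _ := UniformSpace.Completion p.Pre

instance : NormedAddCommGroup p.Compl :=
  inferInstanceAs (NormedAddCommGroup (UniformSpace.Completion p.Pre))
instance : NormedSpace ℂ p.Compl :=
  inferInstanceAs (NormedSpace ℂ (UniformSpace.Completion p.Pre))
instance : CompleteSpace p.Compl :=
  inferInstanceAs (CompleteSpace (UniformSpace.Completion p.Pre))

/-- The canonical map of `D` into its completion. -/
def incl (x : D) : p.Compl := UniformSpace.Completion.coe' (p.toPre x)

theorem norm_incl (x : D) : ‖p.incl x‖ = p x := UniformSpace.Completion.norm_coe (E := p.Pre) x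

theorem incl_add (x y : D) : p.incl (x + y) = p.incl x + p.incl y :=
  UniformSpace.Completion.coe_add (α := p.Pre) x y

theorem incl_smul (c : ℂ) (x : D) : p.incl (c • x) = c • p.incl x :=
  UniformSpace.Completion.coe_smul (X := p.Pre) c x

theorem denseRange_incl : DenseRange p.incl :=
  UniformSpace.Completion.denseRange_coe (α := p.Pre)

/-- The involution of the completion, extending that of `D` by continuity. -/
instance : Star p.Compl :=
  ⟨UniformSpace.Completion.map (α := p.Pre) (β := p.Pre) star⟩

theorem uniformContinuous_star_pre : UniformContinuous (star : p.Pre → p.Pre) := by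
  refine AddMonoidHomClass.uniformContinuous_of_bound
    (starAddEquiv (R := p.Pre)).toAddMonoidHom 1 fun x => ?_
  rw [one_mul]
  exact (Pre.norm_star p x).le

theorem continuous_star_compl : Continuous (star : p.Compl → p.Compl) :=
  UniformSpace.Completion.continuous_map

theorem star_incl (x : D) : star (p.incl x) = p.incl (star x) :=
  UniformSpace.Completion.map_coe (α := p.Pre) (β := p.Pre) (uniformContinuous_star_pre p) x

@[elab_as_elim]
theorem compl_ind {P : p.Compl → Prop} (hP : IsClosed {x | P x}) (h : ∀ x, P (p.incl x))
    (x : p.Compl) : P x :=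
  (denseRange_incl p).induction_on x hP h

end Basic

section Mul

variable {D : Type*} [NonUnitalRing D] [StarRing D] [Module ℂ D]
  [IsScalarTower ℂ D D] [SMulCommClass ℂ D D] (p : CStarSeminorm D)

instance : IsScalarTower ℂ p.Pre p.Pre := inferInstanceAs (IsScalarTower ℂ D D)
instance : SMulCommClass ℂ p.Pre p.Pre := inferInstanceAs (SMulCommClass ℂ D D)

/-- The product of `D` as a bounded bilinear map with values in the completion. -/
def preMulL : p.Pre →L[ℂ] p.Pre →L[ℂ] UniformSpace.Completion p.Pre :=
  LinearMap.mkContinuous₂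
    ((LinearMap.mul ℂ p.Pre).compr₂
      (UniformSpace.Completion.toComplL (𝕜 := ℂ) (E := p.Pre)).toLinearMap) 1 fun x y => by
    have h : ‖((x * y : p.Pre) : UniformSpace.Completion p.Pre)‖ ≤ ‖x‖ * ‖y‖ := by
      rw [UniformSpace.Completion.norm_coe]; exact Pre.norm_mul_le p x y
    simpa using h

/-- The product of the completion, extending that of `D` by continuity. -/
def mulL : p.Compl →L[ℂ] p.Compl →L[ℂ] p.Compl :=
  (ContinuousLinearMap.fromCompletion
    (ContinuousLinearMap.fromCompletion (preMulL p)).flip).flip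

instance : Mul p.Compl := ⟨fun x y => mulL p x y⟩

theorem compl_mul_def (x y : p.Compl) : x * y = mulL p x y := rfl

theorem incl_mul (x y : D) : p.incl (x * y) = p.incl x * p.incl y := by
  have h1 : mulL p (p.incl x) (p.incl y) =
      ContinuousLinearMap.fromCompletion (preMulL p) (p.incl x) (p.toPre y) :=
    congrArg (fun f : p.Compl →L[ℂ] p.Compl => f (p.incl x))
      (ContinuousLinearMap.fromCompletion_apply_coe
        (ContinuousLinearMap.fromCompletion (preMulL p)).flip (p.toPre y))
  have h2 : ContinuousLinearMap.fromCompletion (preMulL p) (p.incl x) = preMulL p (p.toPre x) :=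
    ContinuousLinearMap.fromCompletion_apply_coe (preMulL p) (p.toPre x)
  rw [compl_mul_def, h1, h2]
  rfl

theorem continuous_mul_compl : Continuous fun z : p.Compl × p.Compl => z.1 * z.2 :=
  (mulL p).continuous₂

instance : ContinuousMul p.Compl := ⟨continuous_mul_compl p⟩
instance : ContinuousStar p.Compl := ⟨continuous_star_compl p⟩

instance : NonUnitalRing p.Compl where
  toAddCommGroup := inferInstance
  left_distrib x y z := map_add (mulL p x) y z
  right_distrib x y z := by simp [compl_mul_def]
  zero_mul x := by simp [compl_mul_def]
  mul_zero x := map_zero (mulL p x)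
  mul_assoc x y z := by
    refine compl_ind p (isClosed_eq (by fun_prop) (by fun_prop)) (fun x => ?_) x
    refine compl_ind p (isClosed_eq (by fun_prop) (by fun_prop)) (fun y => ?_) y
    refine compl_ind p (isClosed_eq (by fun_prop) (by fun_prop)) (fun z => ?_) z
    simp only [← incl_mul, mul_assoc]

instance : NonUnitalNormedRing p.Compl where
  __ : NonUnitalRing p.Compl := inferInstance
  __ : NormedAddCommGroup p.Compl := inferInstance
  norm_mul_le x y := by
    refine compl_ind p (isClosed_le (by fun_prop) (by fun_prop)) (fun x => ?_) x
    refine compl_ind p (isClosed_le (by fun_prop) (by fun_prop)) (fun y => ?_) y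
    rw [← incl_mul, norm_incl, norm_incl, norm_incl]
    exact p.mul_le x y

instance : StarRing p.Compl where
  star_involutive x := by
    refine compl_ind p (isClosed_eq (by fun_prop) (by fun_prop)) (fun x => ?_) x
    rw [star_incl, star_incl, star_star]
  star_mul x y := by
    refine compl_ind p (isClosed_eq (by fun_prop) (by fun_prop)) (fun x => ?_) x
    refine compl_ind p (isClosed_eq (by fun_prop) (by fun_prop)) (fun y => ?_) y
    rw [← incl_mul, star_incl, star_incl, star_incl, ← incl_mul, star_mul]
  star_add x y := by
    refine compl_ind p (isClosed_eq (by fun_prop) (by fun_prop)) (fun x => ?_) x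
    refine compl_ind p (isClosed_eq (by fun_prop) (by fun_prop)) (fun y => ?_) y
    rw [← incl_add, star_incl, star_incl, star_incl, ← incl_add, star_add]

instance : CStarRing p.Compl where
  norm_mul_self_le x := by
    refine compl_ind p (isClosed_le (by fun_prop) (by fun_prop)) (fun x => ?_) x
    rw [star_incl, ← incl_mul, norm_incl, norm_incl, p.star_mul_self]

instance : IsScalarTower ℂ p.Compl p.Compl where
  smul_assoc c x y := by simp [compl_mul_def]

instance : SMulCommClass ℂ p.Compl p.Compl where
  smul_comm c x y := by simp [compl_mul_def]

instance [StarModule ℂ D] : StarModule ℂ p.Compl where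
  star_smul c x := by
    have h1 : Continuous fun x : p.Compl => star (c • x) := (continuous_const_smul c).star
    have h2 : Continuous fun x : p.Compl => star c • star x :=
      (continuous_star_compl p).const_smul (star c)
    refine compl_ind p (isClosed_eq h1 h2) (fun x => ?_) x
    rw [← incl_smul, star_incl, star_incl, ← incl_smul, star_smul]

/-- The Hausdorff completion of a ⋆-algebra with respect to a C⋆-seminorm is a C⋆-algebra. -/
instance [StarModule ℂ D] : NonUnitalCStarAlgebra p.Compl where

/-- The canonical order of the C⋆-algebra `p.Compl`. -/
instance [StarModule ℂ D] : PartialOrder p.Compl := CStarAlgebra.spectralOrder _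
instance [StarModule ℂ D] : StarOrderedRing p.Compl := CStarAlgebra.spectralOrderedRing _

end Mul

/-! ### The maximal tensor product -/

section Tensor

variable {A B : Type*} [NonUnitalCStarAlgebra A] [NonUnitalCStarAlgebra B]

/-- `‖a⋆a‖ a⋆a - (a⋆a)²` is of the form `c⋆c`. -/
theorem exists_star_mul_self_add (a : A) :
    ∃ c : A, ((‖a‖ ^ 2 : ℝ) : ℂ) • (star a * a) = star c * c + (star a * a) * (star a * a) := by
  let := CStarAlgebra.spectralOrder A
  have := CStarAlgebra.spectralOrderedRing A
  have h := CStarAlgebra.star_left_conjugate_le_norm_smul (a := a) (b := a * star a)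
    (IsSelfAdjoint.mul_star_self a)
  rw [← sub_nonneg, CStarAlgebra.nonneg_iff_eq_star_mul_self] at h
  obtain ⟨c, hc⟩ := h
  refine ⟨c, ?_⟩
  rw [← hc, CStarRing.norm_self_mul_star, ← sq]
  rw [Complex.coe_smul]
  simp [mul_assoc]

/-- Every C⋆-seminorm on the algebraic tensor product of two C⋆-algebras is a subcross
seminorm. -/
theorem apply_tmul_le (p : CStarSeminorm (A ⊗[ℂ] B)) (a : A) (b : B) :
    p (a ⊗ₜ b) ≤ ‖a‖ * ‖b‖ := by
  obtain ⟨c, hc⟩ := exists_star_mul_self_add a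
  obtain ⟨d, hd⟩ := exists_star_mul_self_add b
  set h := star a * a with hh
  set k := star b * b with hk
  have pos : ∀ (x : A) (y : B), 0 ≤ p.incl ((star x * x) ⊗ₜ[ℂ] (star y * y)) := by
    intro x y
    have : (star x * x) ⊗ₜ[ℂ] (star y * y) = star (x ⊗ₜ[ℂ] y) * (x ⊗ₜ[ℂ] y) := by simp
    rw [this, incl_mul, ← star_incl]
    exact star_mul_self_nonneg _
  have hsa : star h = h := by simp [hh]
  have ksa : star k = k := by simp [hk]
  have key : p.incl ((h * h) ⊗ₜ[ℂ] (k * k)) ≤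
      p.incl ((((‖a‖ ^ 2 : ℝ) : ℂ) • h) ⊗ₜ[ℂ] (((‖b‖ ^ 2 : ℝ) : ℂ) • k)) := by
    rw [hc, hd, TensorProduct.add_tmul, TensorProduct.tmul_add, TensorProduct.tmul_add]
    simp only [incl_add]
    have h1 := pos c d
    have h2 := pos c k
    have h3 := pos h d
    rw [ksa] at h2
    rw [hsa] at h3
    rw [← add_assoc]
    exact le_add_of_nonneg_left (add_nonneg (add_nonneg h1 h2) h3)
  have h0 : 0 ≤ p.incl ((h * h) ⊗ₜ[ℂ] (k * k)) := by
    have := pos h k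
    rwa [hsa, ksa] at this
  have hn := CStarAlgebra.norm_le_norm_of_nonneg_of_le h0 key
  have e1 : (h * h) ⊗ₜ[ℂ] (k * k) = star (h ⊗ₜ[ℂ] k) * (h ⊗ₜ[ℂ] k) := by simp [hsa, ksa]
  have e2 : p (h ⊗ₜ[ℂ] k) = p (a ⊗ₜ b) * p (a ⊗ₜ b) := by
    rw [← p.star_mul_self]; simp [hh, hk]
  rw [e1, norm_incl, p.star_mul_self, TensorProduct.smul_tmul_smul, incl_smul, norm_smul,
    norm_incl, e2] at hn
  have e3 : ‖((‖a‖ ^ 2 : ℝ) : ℂ) * ((‖b‖ ^ 2 : ℝ) : ℂ)‖ = (‖a‖ * ‖b‖) ^ 2 := by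
    rw [norm_mul, Complex.norm_real, Complex.norm_real]
    simp [mul_pow]
  rw [e3] at hn
  have h4 := p.nonneg (a ⊗ₜ b)
  by_contra! hlt
  have h5 : 0 ≤ ‖a‖ * ‖b‖ := by positivity
  have h6 : 0 < p (a ⊗ₜ b) := h5.trans_lt hlt
  have h7 : 0 < p (a ⊗ₜ b) * p (a ⊗ₜ b) := mul_pos h6 h6
  have h8 := le_of_mul_le_mul_right hn h7
  nlinarith

theorem bddAbove (x : A ⊗[ℂ] B) :
    BddAbove (Set.range fun p : CStarSeminorm (A ⊗[ℂ] B) => p x) := by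
  suffices ∃ C : ℝ, ∀ p : CStarSeminorm (A ⊗[ℂ] B), p x ≤ C by
    obtain ⟨C, hC⟩ := this
    exact ⟨C, by rintro _ ⟨p, rfl⟩; exact hC p⟩
  induction x using TensorProduct.induction_on with
  | zero => exact ⟨0, fun p => (map_zero p.toSeminorm).le⟩
  | tmul a b => exact ⟨_, fun p => apply_tmul_le p a b⟩
  | add x y hx hy =>
    obtain ⟨C, hC⟩ := hx
    obtain ⟨C', hC'⟩ := hy
    exact ⟨C + C', fun p => (map_add_le_add p.toSeminorm x y).trans (add_le_add (hC p) (hC' p))⟩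

theorem le_iSup (p : CStarSeminorm (A ⊗[ℂ] B)) (x : A ⊗[ℂ] B) :
    p x ≤ ⨆ q : CStarSeminorm (A ⊗[ℂ] B), q x :=
  le_ciSup (f := fun q : CStarSeminorm (A ⊗[ℂ] B) => q x) (bddAbove x) p

variable (A B) in
/-- The maximal C⋆-norm on the algebraic tensor product of two C⋆-algebras: the supremum of all
C⋆-seminorms. -/
def maxTensor : CStarSeminorm (A ⊗[ℂ] B) where
  toFun x := ⨆ p : CStarSeminorm (A ⊗[ℂ] B), p x
  map_zero' := by simp
  add_le' x y := ciSup_le fun p =>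
    (map_add_le_add p.toSeminorm x y).trans (add_le_add (le_iSup p x) (le_iSup p y))
  neg' x := by simp
  smul' c x := by
    simp only [map_smul_eq_mul]
    exact (Real.mul_iSup_of_nonneg (norm_nonneg c) _).symm
  mul_le' x y := ciSup_le fun p =>
    (p.mul_le x y).trans (mul_le_mul (le_iSup p x) (le_iSup p y) (p.nonneg y)
      ((p.nonneg x).trans (le_iSup p x)))
  star_mul_self' x := by
    apply le_antisymm
    · exact ciSup_le fun p => (p.star_mul_self x).le.trans
        (mul_self_le_mul_self (p.nonneg x) (le_iSup p x))
    · have h0 : 0 ≤ ⨆ p : CStarSeminorm (A ⊗[ℂ] B), p (star x * x) :=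
        Real.iSup_nonneg fun p => p.nonneg _
      rw [← Real.mul_self_sqrt h0]
      refine mul_self_le_mul_self (Real.iSup_nonneg fun p => p.nonneg x) (ciSup_le fun p => ?_)
      apply Real.le_sqrt_of_sq_le
      rw [sq, ← p.star_mul_self]
      exact le_iSup p _

theorem le_maxTensor (p : CStarSeminorm (A ⊗[ℂ] B)) (x : A ⊗[ℂ] B) : p x ≤ maxTensor A B x :=
  le_iSup p x

end Tensor

end CStarSeminorm

/-- The maximal C⋆-tensor product `A ⊗_max B`: the completion of the algebraic tensor product
in the maximal C⋆-norm. -/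
def MaxTensorProduct (A B : Type*) [NonUnitalCStarAlgebra A] [NonUnitalCStarAlgebra B] : Type _ :=
  (CStarSeminorm.maxTensor A B).Compl

namespace MaxTensorProduct

variable {A B : Type*} [NonUnitalCStarAlgebra A] [NonUnitalCStarAlgebra B]

instance : NonUnitalCStarAlgebra (MaxTensorProduct A B) :=
  inferInstanceAs (NonUnitalCStarAlgebra (CStarSeminorm.maxTensor A B).Compl)

/-- The canonical order of the C⋆-algebra `A ⊗_max B`. -/
instance : PartialOrder (MaxTensorProduct A B) := CStarAlgebra.spectralOrder _
instance : StarOrderedRing (MaxTensorProduct A B) := CStarAlgebra.spectralOrderedRing _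

/-- The canonical ⋆-homomorphism of the algebraic tensor product into `A ⊗_max B`. -/
def of : A ⊗[ℂ] B →⋆ₙₐ[ℂ] MaxTensorProduct A B where
  toFun := (CStarSeminorm.maxTensor A B).incl
  map_smul' := CStarSeminorm.incl_smul _
  map_zero' := UniformSpace.Completion.coe_zero (α := (CStarSeminorm.maxTensor A B).Pre)
  map_add' := CStarSeminorm.incl_add _
  map_mul' := CStarSeminorm.incl_mul _
  map_star' x := (CStarSeminorm.star_incl _ x).symm

theorem norm_of (x : A ⊗[ℂ] B) : ‖of x‖ = CStarSeminorm.maxTensor A B x :=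
  CStarSeminorm.norm_incl _ x

theorem denseRange_of : DenseRange (of : A ⊗[ℂ] B → MaxTensorProduct A B) :=
  CStarSeminorm.denseRange_incl _

/-- The elementary tensor `a ⊗ b` in `A ⊗_max B`. -/
def tmul (a : A) (b : B) : MaxTensorProduct A B := of (a ⊗ₜ[ℂ] b)

end MaxTensorProduct

/-! ### Completely bounded maps -/

/-- A linear map between C⋆-algebras is completely bounded if its amplifications to matrices
of all sizes are uniformly bounded. -/
def IsCompletelyBounded {A B : Type*} [NonUnitalCStarAlgebra A] [PartialOrder A]
    [StarOrderedRing A] [NonUnitalCStarAlgebra B] [PartialOrder B] [StarOrderedRing B]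
    (f : A →ₗ[ℂ] B) : Prop :=
  ∃ C : ℝ, ∀ (n : ℕ) (X : CStarMatrix (Fin n) (Fin n) A), ‖X.map f‖ ≤ C * ‖X‖

/-! ### A von Neumann algebra as a C⋆-algebra -/

namespace VonNeumannAlgebra

variable {H : Type*} [NormedAddCommGroup H] [InnerProductSpace ℂ H] [CompleteSpace H]

instance instSMulMemClass : SMulMemClass (VonNeumannAlgebra H) ℂ (H →L[ℂ] H) where
  smul_mem {s} c _ hx := s.toStarSubalgebra.smul_mem hx c

theorem isClosed (M : VonNeumannAlgebra H) : IsClosed (M : Set (H →L[ℂ] H)) := by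
  rw [← M.centralizer_centralizer]
  exact Set.isClosed_centralizer _

instance instCStarAlgebra (M : VonNeumannAlgebra H) : CStarAlgebra M :=
  StarSubalgebra.cstarAlgebra M (h_closed := M.isClosed)

/-- The order inherited from the operator order of `B(H)` is the canonical order of the
C⋆-algebra `M`. -/
instance instStarOrderedRing (M : VonNeumannAlgebra H) : StarOrderedRing M := by
  refine StarOrderedRing.of_nonneg_iff' (fun {x y} hxy z => ?_) fun x => ⟨fun hx => ?_, ?_⟩
  · exact add_le_add_right (α := H →L[ℂ] H) hxy (z : H →L[ℂ] H)
  · have hx' : 0 ≤ (x : H →L[ℂ] H) := hx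
    have hmem : CFC.sqrt (x : H →L[ℂ] H) ∈ M := by
      rw [← SetLike.mem_coe, ← M.centralizer_centralizer]
      intro y hy
      have hc : Commute (x : H →L[ℂ] H) y := hy _ x.2
      exact (hc.cfcₙ_nnreal NNReal.sqrt).eq.symm
    refine ⟨⟨_, hmem⟩, Subtype.ext ?_⟩
    have hs : star (CFC.sqrt (x : H →L[ℂ] H)) = CFC.sqrt (x : H →L[ℂ] H) :=
      (IsSelfAdjoint.of_nonneg (CFC.sqrt_nonneg _)).star_eq
    change (x : H →L[ℂ] H) = star (CFC.sqrt (x : H →L[ℂ] H)) * CFC.sqrt (x : H →L[ℂ] H)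
    rw [hs, CFC.sqrt_mul_sqrt_self _ hx']
  · rintro ⟨s, rfl⟩
    exact star_mul_self_nonneg (s : H →L[ℂ] H)

end VonNeumannAlgebra

end

/-!
Let `s` be a positive form on `A ⊗ H` that is bounded by a multiple of `‖h‖ ^ 2` at `e ⊗ h` for `e`
in an approximate unit, for which left multiplications by `a` and `star a` are adjoint, and which
dominates the evaluation map `Q : a ⊗ h ↦ φ(a) h`. Then `Q` extends to the Hilbert space of `s`, and
`N = Q Q⋆` is a positive operator with `φ(a) N = N φ(a*)*`. It is bounded below on the support of
`φ`: if `E` is the support idempotent, a weak limit of `φ` along the approximate unit, then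
`E N E⋆ + (1 - E) (1 - E)⋆` is positive, invertible, and intertwines `φ` with `a ↦ φ(a*)*`.
Conjugating by its square root turns `φ` into a ⋆-homomorphism, and everything stays in `M` once
`s` is invariant under `M'`.

From (4), the form is `⟪k, φ₁(b* a) h⟫` and the domination is the Cauchy–Schwarz inequality for the
`2 × 2` form of `Ψ`. From (2), the form lives on the tensor product of the unitization of
`A ⊗_max M'` with `H`, and is produced by the Hahn–Banach theorem (Paulsen's argument); after
diagonalizing `∑ₗ |hₗ⟩⟨hₗ|`, complete boundedness of `Φ` is exactly the finite inequality needed.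
-/

noncomputable section

/-! ### Nonnegative forms and the operators they induce -/

section Forms

open scoped ComplexOrder InnerProductSpace
open ComplexConjugate

variable {H : Type*} [NormedAddCommGroup H] [InnerProductSpace ℂ H] [CompleteSpace H]

theorem le_of_sq_le_mul_self {q C : ℝ} (hC : 0 ≤ C) (h : q ^ 2 ≤ C * q) : q ≤ C := by
  by_contra! hq
  nlinarith

section Seminormed

variable {F : Type*} [SeminormedAddCommGroup F] [InnerProductSpace ℂ F]

/-- The positive operator `q q⋆` on `H`, the adjoint being that of the extension of `q` to the
Hilbert space completion of `F`. -/
def selfCompAdjoint (q : F →L[ℂ] H) : H →L[ℂ] H :=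
  q.fromCompletion ∘L q.fromCompletion.adjoint

theorem selfCompAdjoint_nonneg (q : F →L[ℂ] H) : 0 ≤ selfCompAdjoint q := by
  rw [ContinuousLinearMap.nonneg_iff_isPositive]
  exact ContinuousLinearMap.isPositive_self_comp_adjoint _

theorem comp_fromCompletion_eq {q : F →L[ℂ] H} {l : F →L[ℂ] F} {x : H →L[ℂ] H}
    (h : ∀ ξ, q (l ξ) = x (q ξ)) : x ∘L q.fromCompletion = q.fromCompletion ∘L l.completion := by
  ext k
  induction k using UniformSpace.Completion.induction_on with
  | hp => exact isClosed_eq (by fun_prop) (by fun_prop)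
  | ih ξ => simp [h]

theorem completion_eq_adjoint {l l' : F →L[ℂ] F} (h : ∀ ξ η, ⟪l ξ, η⟫_ℂ = ⟪ξ, l' η⟫_ℂ) :
    l.completion = l'.completion.adjoint := by
  rw [ContinuousLinearMap.eq_adjoint_iff]
  intro a b
  induction a, b using UniformSpace.Completion.induction_on₂ with
  | hp => exact isClosed_eq (by fun_prop) (by fun_prop)
  | ih ξ η => simp [UniformSpace.Completion.inner_coe, h]

theorem mul_selfCompAdjoint {q : F →L[ℂ] H} {l l' : F →L[ℂ] F} {x y : H →L[ℂ] H}
    (hl : ∀ ξ η, ⟪l ξ, η⟫_ℂ = ⟪ξ, l' η⟫_ℂ) (hx : ∀ ξ, q (l ξ) = x (q ξ))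
    (hy : ∀ ξ, q (l' ξ) = y (q ξ)) : x * selfCompAdjoint q = selfCompAdjoint q * star y := by
  change x ∘L (q.fromCompletion ∘L q.fromCompletion.adjoint) =
    (q.fromCompletion ∘L q.fromCompletion.adjoint) ∘L y.adjoint
  rw [ContinuousLinearMap.comp_assoc, ← ContinuousLinearMap.adjoint_comp,
    comp_fromCompletion_eq hy, ContinuousLinearMap.adjoint_comp, ← completion_eq_adjoint hl,
    ← ContinuousLinearMap.comp_assoc, comp_fromCompletion_eq hx, ContinuousLinearMap.comp_assoc]

theorem norm_inner_sq_le_selfCompAdjoint (q : F →L[ℂ] H) (k : H) (ξ : F) :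
    ‖⟪k, q ξ⟫_ℂ‖ ^ 2 ≤ ‖ξ‖ ^ 2 * RCLike.re ⟪k, selfCompAdjoint q k⟫_ℂ := by
  have inner_q : ⟪k, q ξ⟫_ℂ = ⟪q.fromCompletion.adjoint k, (ξ : UniformSpace.Completion F)⟫_ℂ := by
    rw [ContinuousLinearMap.adjoint_inner_left, ContinuousLinearMap.fromCompletion_apply_coe]
  have re_inner_self : RCLike.re ⟪k, selfCompAdjoint q k⟫_ℂ = ‖q.fromCompletion.adjoint k‖ ^ 2 := by
    rw [← inner_self_eq_norm_sq (𝕜 := ℂ), ContinuousLinearMap.adjoint_inner_left]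
    rfl
  rw [inner_q, re_inner_self, ← UniformSpace.Completion.norm_coe ξ, ← mul_pow, mul_comm]
  exact pow_le_pow_left₀ (norm_nonneg _) (norm_inner_le_norm _ _) 2

end Seminormed

variable {F : Type*} [AddCommGroup F] [Module ℂ F] {s : F →ₗ⋆[ℂ] F →ₗ[ℂ] ℂ}

theorem conj_apply_of_isNonneg (hs : s.IsNonneg) (ξ η : F) : conj (s η ξ) = s ξ η := by
  have im_apply_self (ζ : F) : (s ζ ζ).im = 0 := (Complex.nonneg_iff.mp (hs.nonneg ζ)).2.symm
  have h1 := im_apply_self (ξ + η)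
  have h2 := im_apply_self (ξ + Complex.I • η)
  simp only [map_add, LinearMap.add_apply, Complex.add_im, im_apply_self, LinearMap.map_smulₛₗ,
    Complex.conj_I, LinearMap.smul_apply, RingHom.id_apply, smul_eq_mul, Complex.mul_im,
    Complex.add_re, Complex.mul_re, Complex.neg_re, Complex.neg_im, Complex.I_re,
    Complex.I_im] at h1 h2
  apply Complex.ext
  · simp only [Complex.conj_re]; linarith
  · simp only [Complex.conj_im]; linarith

/-- The semi-inner product given by a nonnegative form. -/
abbrev coreOfIsNonneg (hs : s.IsNonneg) : PreInnerProductSpace.Core ℂ F where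
  inner ξ η := s ξ η
  conj_inner_symm := conj_apply_of_isNonneg hs
  re_inner_nonneg ξ := (Complex.nonneg_iff.mp (hs.nonneg ξ)).1
  add_left ξ η ζ := by simp
  smul_left ξ η c := by simp

theorem norm_apply_sq_le_of_isNonneg (hs : s.IsNonneg) (ξ η : F) :
    ‖s ξ η‖ ^ 2 ≤ (s ξ ξ).re * (s η η).re := by
  let _ := coreOfIsNonneg hs
  have norm_symm : ‖s ξ η‖ = ‖s η ξ‖ := by
    rw [← conj_apply_of_isNonneg hs ξ η, RCLike.norm_conj]
  calc ‖s ξ η‖ ^ 2 = ‖s ξ η‖ * ‖s η ξ‖ := by rw [← norm_symm, sq]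
    _ ≤ _ := InnerProductSpace.Core.inner_mul_inner_self_le (𝕜 := ℂ) ξ η

/-- The form `(ξ, η) ↦ (s(ξ, η) + conj s(η, ξ)) / 2`. -/
def hermitianPart (s : F →ₗ⋆[ℂ] F →ₗ[ℂ] ℂ) : F →ₗ⋆[ℂ] F →ₗ[ℂ] ℂ :=
  LinearMap.mk₂'ₛₗ (starRingEnd ℂ) (RingHom.id ℂ) (fun ξ η => (s ξ η + conj (s η ξ)) / 2)
    (fun _ _ _ => by simp only [map_add, LinearMap.add_apply]; ring)
    (fun _ _ _ => by
      simp only [map_smulₛₗ, LinearMap.smul_apply, RingHom.id_apply, smul_eq_mul, map_mul]; ring)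
    (fun _ _ _ => by simp only [map_add, LinearMap.add_apply]; ring)
    (fun _ _ _ => by
      simp only [map_smulₛₗ, LinearMap.smul_apply, RingHom.id_apply, smul_eq_mul, map_mul,
        Complex.conj_conj]; ring)

theorem hermitianPart_apply (ξ η : F) : hermitianPart s ξ η = (s ξ η + conj (s η ξ)) / 2 := rfl

theorem hermitianPart_apply_self (ξ : F) : hermitianPart s ξ ξ = (s ξ ξ).re := by
  rw [hermitianPart_apply, Complex.add_conj]
  push_cast
  ring

/-- `L` is bounded for the seminorm `ξ ↦ s(ξ, ξ)^{1/2}` of the nonnegative form `s`. -/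
def IsFormBounded (s : F →ₗ⋆[ℂ] F →ₗ[ℂ] ℂ) (L : F →ₗ[ℂ] F) : Prop :=
  ∃ c : ℝ, 0 ≤ c ∧ ∀ ξ, (s (L ξ) (L ξ)).re ≤ c * (s ξ ξ).re

/-- The properties that characterise `N` as the operator `Q Q⋆`, where `Q⋆` is the adjoint of `Q`
with respect to the semi-inner product `s` on `F` and the inner product of `H`. -/
structure IsPushforward (s : F →ₗ⋆[ℂ] F →ₗ[ℂ] ℂ) (Q : F →ₗ[ℂ] H) (N : H →L[ℂ] H) : Prop where
  nonneg : 0 ≤ N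
  mul_eq_mul_star : ∀ {L L' : F →ₗ[ℂ] F} {x y : H →L[ℂ] H}, IsFormBounded s L →
    IsFormBounded s L' → (∀ ξ η, s (L ξ) η = s ξ (L' η)) → (∀ ξ, Q (L ξ) = x (Q ξ)) →
    (∀ ξ, Q (L' ξ) = y (Q ξ)) → x * N = N * star y
  norm_inner_sq_le : ∀ k ξ, ‖⟪k, Q ξ⟫_ℂ‖ ^ 2 ≤ (s ξ ξ).re * RCLike.re ⟪k, N k⟫_ℂ

theorem exists_isPushforward (hs : s.IsNonneg) (Q : F →ₗ[ℂ] H) {C : ℝ} (hC : 0 ≤ C)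
    (hQ : ∀ ξ, ‖Q ξ‖ ^ 2 ≤ C * (s ξ ξ).re) : ∃ N : H →L[ℂ] H, IsPushforward s Q N := by
  let core := coreOfIsNonneg hs
  let : SeminormedAddCommGroup F := InnerProductSpace.Core.toSeminormedAddCommGroup (𝕜 := ℂ)
  let : InnerProductSpace ℂ F := InnerProductSpace.ofCore core
  have norm_sq (ξ : F) : ‖ξ‖ ^ 2 = (s ξ ξ).re := norm_sq_eq_re_inner (𝕜 := ℂ) ξ
  have le_sqrt_mul {a b d : ℝ} (hd : 0 ≤ d) (hb : 0 ≤ b) (h : a ^ 2 ≤ b * d ^ 2) : a ≤ √b * d :=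
    (abs_le_of_sq_le_sq' (by rwa [mul_pow, Real.sq_sqrt hb]) (by positivity)).2
  have bound {L : F →ₗ[ℂ] F} (hL : IsFormBounded s L) : ∃ c : ℝ, ∀ ξ, ‖L ξ‖ ≤ c * ‖ξ‖ := by
    obtain ⟨c, hc, hL⟩ := hL
    exact ⟨√c, fun ξ => le_sqrt_mul (norm_nonneg _) hc (by simpa only [norm_sq] using hL ξ)⟩
  let q : F →L[ℂ] H := Q.mkContinuous (√C) fun ξ =>
    le_sqrt_mul (norm_nonneg _) hC (by simpa only [norm_sq] using hQ ξ)
  refine ⟨selfCompAdjoint q, selfCompAdjoint_nonneg q, fun {L L' x y} hL hL' hadj hx hy => ?_,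
    fun k ξ => ?_⟩
  · obtain ⟨c, hc⟩ := bound hL
    obtain ⟨c', hc'⟩ := bound hL'
    exact mul_selfCompAdjoint (l := L.mkContinuous c hc) (l' := L'.mkContinuous c' hc') hadj hx hy
  · rw [← norm_sq]
    exact norm_inner_sq_le_selfCompAdjoint q k ξ

end Forms

/-! ### Sesquilinear kernels on `B ⊗ X` -/

section Kernel

open scoped ComplexOrder
open ComplexConjugate

variable {B : Type*} [NonUnitalCStarAlgebra B] {X V : Type*} [AddCommGroup X] [Module ℂ X]
  [AddCommGroup V] [Module ℂ V]

/-- The sesquilinear map `(b ⊗ k, a ⊗ h) ↦ t (b⋆ a) k h` on `B ⊗ X`, as in Stinespring's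
construction. -/
def kernelForm (t : B →ₗ[ℂ] X →ₗ⋆[ℂ] X →ₗ[ℂ] V) : B ⊗[ℂ] X →ₗ⋆[ℂ] B ⊗[ℂ] X →ₗ[ℂ] V :=
  TensorProduct.lift <| LinearMap.mk₂'ₛₗ (starRingEnd ℂ) (starRingEnd ℂ)
    (fun b k => TensorProduct.lift <| LinearMap.mk₂ ℂ (fun a h => t (star b * a) k h)
      (by simp [mul_add]) (by simp [mul_smul_comm]) (by simp) (by simp))
    (fun _ _ _ => TensorProduct.ext' fun _ _ => by simp [add_mul])
    (fun _ _ _ => TensorProduct.ext' fun _ _ => by simp [smul_mul_assoc])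
    (fun _ _ _ => TensorProduct.ext' fun _ _ => by simp)
    (fun _ _ _ => TensorProduct.ext' fun _ _ => by simp)

@[simp]
theorem kernelForm_tmul (t : B →ₗ[ℂ] X →ₗ⋆[ℂ] X →ₗ[ℂ] V) (a b : B) (h k : X) :
    kernelForm t (b ⊗ₜ k) (a ⊗ₜ h) = t (star b * a) k h := rfl

variable (X) in
/-- Left multiplication by `c` on `B ⊗ X`. -/
def leftMul (c : B) : B ⊗[ℂ] X →ₗ[ℂ] B ⊗[ℂ] X :=
  LinearMap.rTensor X (LinearMap.mul ℂ B c)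

@[simp]
theorem leftMul_tmul (c a : B) (h : X) : leftMul X c (a ⊗ₜ h) = (c * a) ⊗ₜ h := rfl

theorem leftMul_mul (c d : B) : leftMul X (c * d) = leftMul X c ∘ₗ leftMul X d := by
  ext
  simp [mul_assoc]

theorem leftMul_add (c d : B) : leftMul X (c + d) = leftMul X c + leftMul X d := by
  simp [leftMul, LinearMap.rTensor_add]

theorem leftMul_smul (r : ℂ) (d : B) : leftMul X (r • d) = r • leftMul X d := by
  simp [leftMul, LinearMap.rTensor_smul]

theorem kernelForm_leftMul (t : B →ₗ[ℂ] X →ₗ⋆[ℂ] X →ₗ[ℂ] V) (c : B) (ξ η : B ⊗[ℂ] X) :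
    kernelForm t (leftMul X c ξ) η = kernelForm t ξ (leftMul X (star c) η) := by
  have : (kernelForm t).comp (leftMul X c) = (kernelForm t).compl₂ (leftMul X (star c)) := by
    ext
    simp [mul_assoc]
  exact LinearMap.congr_fun₂ this ξ η

theorem kernelForm_lTensor {Y : Type*} [AddCommGroup Y] [Module ℂ Y]
    {t : B →ₗ[ℂ] X →ₗ⋆[ℂ] X →ₗ[ℂ] V} {t' : B →ₗ[ℂ] Y →ₗ⋆[ℂ] Y →ₗ[ℂ] V}
    {u v : Y →ₗ[ℂ] X} {w : Y →ₗ[ℂ] Y} (h : ∀ b k h, t b (u k) (v h) = t' b k (w h))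
    (ξ η : B ⊗[ℂ] Y) :
    kernelForm t (LinearMap.lTensor B u ξ) (LinearMap.lTensor B v η) =
      kernelForm t' ξ (LinearMap.lTensor B w η) := by
  have : ((kernelForm t).comp (LinearMap.lTensor B u)).compl₂ (LinearMap.lTensor B v) =
      (kernelForm t').compl₂ (LinearMap.lTensor B w) := by
    ext
    simp [h]
  exact LinearMap.congr_fun₂ this ξ η

theorem exists_sum_tmul {R M N : Type*} [CommSemiring R] [AddCommMonoid M] [Module R M]
    [AddCommMonoid N] [Module R N] (ξ : M ⊗[R] N) :
    ∃ (n : ℕ) (b : Fin n → M) (h : Fin n → N), ξ = ∑ i, b i ⊗ₜ[R] h i := by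
  obtain ⟨S, rfl⟩ := TensorProduct.exists_finset ξ
  refine ⟨S.card, fun i => (S.equivFin.symm i).1.1, fun i => (S.equivFin.symm i).1.2, ?_⟩
  rw [← Finset.sum_coe_sort S]
  exact (Equiv.sum_comp S.equivFin.symm fun i : S => i.1.1 ⊗ₜ[R] i.1.2).symm

theorem kernelForm_isNonneg {t : B →ₗ[ℂ] X →ₗ⋆[ℂ] X →ₗ[ℂ] ℂ}
    (ht : ∀ (n : ℕ) (b : Fin n → B) (h : Fin n → X),
      0 ≤ ∑ i, ∑ j, t (star (b i) * b j) (h i) (h j)) : (kernelForm t).IsNonneg := by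
  refine ⟨fun ξ => ?_⟩
  obtain ⟨n, b, h, rfl⟩ := exists_sum_tmul ξ
  refine (ht n b h).trans_eq ?_
  rw [Finset.sum_comm]
  simp [map_sum]

theorem isFormBounded_leftMul {s : B ⊗[ℂ] X →ₗ⋆[ℂ] B ⊗[ℂ] X →ₗ[ℂ] ℂ} (hs : s.IsNonneg)
    (hadj : ∀ c ξ η, s (leftMul X c ξ) η = s ξ (leftMul X (star c) η)) (a : B) :
    IsFormBounded s (leftMul X a) := by
  refine ⟨‖a‖ ^ 2, by positivity, fun ξ => ?_⟩
  obtain ⟨c, hc⟩ := CStarSeminorm.exists_star_mul_self_add a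
  have re_nonneg (ξ) : 0 ≤ (s ξ ξ).re := (Complex.nonneg_iff.mp (hs.nonneg ξ)).1
  have leftMul_leftMul (b : B) :
      s (leftMul X b ξ) (leftMul X b ξ) = s ξ (leftMul X (star b * b) ξ) := by
    rw [hadj, leftMul_mul, LinearMap.comp_apply]
  have split : ‖a‖ ^ 2 * (s (leftMul X a ξ) (leftMul X a ξ)).re =
      (s (leftMul X c ξ) (leftMul X c ξ)).re +
      (s (leftMul X (star a * a) ξ) (leftMul X (star a * a) ξ)).re := by
    have := congrArg (fun z => (s ξ (leftMul X z ξ)).re) hc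
    simp only [leftMul_smul, leftMul_add, LinearMap.smul_apply, LinearMap.add_apply, map_add,
      map_smul, smul_eq_mul, Complex.re_ofReal_mul, Complex.add_re] at this
    simp only [leftMul_leftMul, this]
    simp
  apply le_of_sq_le_mul_self (mul_nonneg (by positivity) (re_nonneg ξ))
  calc (s (leftMul X a ξ) (leftMul X a ξ)).re ^ 2
      ≤ ‖s ξ (leftMul X (star a * a) ξ)‖ ^ 2 := by
        rw [← leftMul_leftMul]
        exact pow_le_pow_left₀ (re_nonneg _) (Complex.re_le_norm _) 2
    _ ≤ (s ξ ξ).re * (s (leftMul X (star a * a) ξ) (leftMul X (star a * a) ξ)).re :=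
        norm_apply_sq_le_of_isNonneg hs ξ _
    _ ≤ (s ξ ξ).re * (‖a‖ ^ 2 * (s (leftMul X a ξ) (leftMul X a ξ)).re) := by
        gcongr
        · exact re_nonneg ξ
        · linarith [re_nonneg (leftMul X c ξ)]
    _ = ‖a‖ ^ 2 * (s ξ ξ).re * (s (leftMul X a ξ) (leftMul X a ξ)).re := by ring

end Kernel

/-! ### Completely positive maps -/

section CompletelyPositive

theorem cstarMatrix_ofMatrix_apply {m n R : Type*} (f : m → n → R) (i : m) (j : n) :
    CStarMatrix.ofMatrix f i j = f i j := rfl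

theorem cstarMatrix_sum_apply {m n ι R : Type*} [AddCommMonoid R] (s : Finset ι)
    (f : ι → CStarMatrix m n R) (i : m) (j : n) : (∑ k ∈ s, f k) i j = ∑ k ∈ s, f k i j :=
  Matrix.sum_apply i j s f

open Classical in
/-- The matrix whose row `i₀` is `y` and whose other rows vanish. -/
def rowMatrix {B m : Type*} [NonUnitalCStarAlgebra B] (i₀ : m) (y : m → B) : CStarMatrix m m B :=
  CStarMatrix.ofMatrix fun i j => if i = i₀ then y j else 0

theorem star_rowMatrix_mul_rowMatrix {B m : Type*} [NonUnitalCStarAlgebra B] [Fintype m] (i₀ : m)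
    (y z : m → B) (i j : m) :
    (star (rowMatrix i₀ y) * rowMatrix i₀ z) i j = star (y i) * z j := by
  simp only [CStarMatrix.mul_apply, CStarMatrix.star_apply, rowMatrix, cstarMatrix_ofMatrix_apply]
  rw [Finset.sum_eq_single i₀ (fun _ _ h => by simp [h]) (by simp)]
  simp

variable {A B : Type*} [NonUnitalCStarAlgebra A] [PartialOrder A] [StarOrderedRing A]
  [NonUnitalCStarAlgebra B] [PartialOrder B] [StarOrderedRing B]

theorem exists_eq_star_mul_self_of_nonneg {a : B} (ha : 0 ≤ a) : ∃ b : B, a = star b * b :=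
  CStarAlgebra.nonneg_iff_eq_star_mul_self.mp ha

theorem cstarMatrix_nonneg_of_eq_sum {n κ : Type*} [Fintype n] [Fintype κ] {M : CStarMatrix n n B}
    (Y : κ → n → B) (hM : ∀ i j, M i j = ∑ k, star (Y k i) * Y k j) : 0 ≤ M := by
  rcases isEmpty_or_nonempty n with hn | ⟨⟨i₀⟩⟩
  · exact (CStarMatrix.ext fun i => hn.elim i : (0 : CStarMatrix n n B) = M).le
  have : M = ∑ k, star (rowMatrix i₀ (Y k)) * rowMatrix i₀ (Y k) := by
    ext i j
    simp only [hM, cstarMatrix_sum_apply, star_rowMatrix_mul_rowMatrix]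
  rw [this]
  exact Finset.sum_nonneg fun k _ => star_mul_self_nonneg _

theorem exists_eq_sum_of_cstarMatrix_nonneg {n : Type*} [Fintype n] {M : CStarMatrix n n B}
    (hM : 0 ≤ M) : ∃ Y : n → n → B, ∀ i j, M i j = ∑ k, star (Y k i) * Y k j := by
  obtain ⟨X, rfl⟩ := exists_eq_star_mul_self_of_nonneg hM
  exact ⟨X, fun i j => by simp only [CStarMatrix.mul_apply, CStarMatrix.star_apply]⟩

theorem completelyPositiveMap_exists_eq_sum (f : A →CP B) {n : Type*} [Fintype n]
    {M : CStarMatrix n n A} (hM : 0 ≤ M) :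
    ∃ Y : n → n → B, ∀ i j, f (M i j) = ∑ k, star (Y k i) * Y k j :=
  exists_eq_sum_of_cstarMatrix_nonneg (f.map_cstarMatrix_nonneg M hM)

theorem completelyPositiveMap_exists_eq_sum_of_family (f : A →CP B) {n : Type*} [Fintype n]
    (b : n → A) : ∃ Y : n → n → B, ∀ i j, f (star (b i) * b j) = ∑ k, star (Y k i) * Y k j :=
  completelyPositiveMap_exists_eq_sum f
    (M := CStarMatrix.ofMatrix fun i j => star (b i) * b j)
    (cstarMatrix_nonneg_of_eq_sum (κ := Unit) (fun _ => b) (by simp [cstarMatrix_ofMatrix_apply]))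

theorem completelyPositiveMap_exists_norm_le (f : A →CP B) :
    ∃ C : ℝ, 0 ≤ C ∧ ∀ a, ‖f a‖ ≤ C * ‖a‖ :=
  let ⟨C, hC⟩ := PositiveLinearMap.exists_norm_apply_le (.ofClass f : A →ₚ[ℂ] B)
  ⟨C, C.2, hC⟩

theorem completelyPositiveMap_map_star (f : A →CP B) (a : A) : f (star a) = star (f a) :=
  map_star (.ofClass f : A →ₚ[ℂ] B) a

/-- The completely positive map `a ↦ ∑ i, Vᵢ⋆ ψᵢ(a) Vᵢ`, where each `Vᵢ` is a row with entries
in `B`. -/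
def conjSum {ι m : Type*} [Fintype ι] [Fintype m] (ψ : ι → (A →CP B)) (V : ι → m → B) :
    A →CP CStarMatrix m m B where
  toFun a := CStarMatrix.ofMatrix fun p q => ∑ i, star (V i p) * (ψ i a * V i q)
  map_add' a b := by
    ext
    simp [add_mul, mul_add, Finset.sum_add_distrib, cstarMatrix_ofMatrix_apply]
  map_smul' c a := by
    ext
    simp [Finset.smul_sum, smul_mul_assoc, mul_smul_comm, cstarMatrix_ofMatrix_apply]
  map_cstarMatrix_nonneg' k M hM := by
    rcases isEmpty_or_nonempty m with hm | ⟨⟨p₀⟩⟩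
    · exact (CStarMatrix.ext fun i j => CStarMatrix.ext fun p => hm.elim p :
        (0 : CStarMatrix (Fin k) (Fin k) (CStarMatrix m m B)) = _).le
    choose Y hY using fun i => completelyPositiveMap_exists_eq_sum (ψ i) hM
    refine cstarMatrix_nonneg_of_eq_sum
      (fun (l : ι × Fin k) j => rowMatrix p₀ fun q => Y l.1 l.2 j * V l.1 q) fun i j => ?_
    ext p q
    simp [hY, cstarMatrix_sum_apply, star_rowMatrix_mul_rowMatrix, Fintype.sum_prod_type,
      Finset.mul_sum, Finset.sum_mul, mul_assoc, cstarMatrix_ofMatrix_apply]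

theorem conjSum_apply {ι m : Type*} [Fintype ι] [Fintype m] (ψ : ι → (A →CP B)) (V : ι → m → B)
    (a : A) (p q : m) : conjSum ψ V a p q = ∑ i, star (V i p) * (ψ i a * V i q) := rfl

/-- The compression `a ↦ ∑ p q, conj(v p) v(q) Ψ(a)ₚᵩ` of a matrix-valued completely positive map
to a vector of scalars. -/
def compress {m : Type*} [Fintype m] (Ψ : A →CP CStarMatrix m m B) (v : m → ℂ) : A →CP B where
  toFun a := ∑ p, ∑ q, (star (v p) * v q) • Ψ a p q
  map_add' a b := by simp [Finset.sum_add_distrib]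
  map_smul' c a := by
    simp only [map_smul, CStarMatrix.smul_apply, Finset.smul_sum, RingHom.id_apply, smul_comm c]
  map_cstarMatrix_nonneg' k M hM := by
    obtain ⟨Y, hY⟩ := completelyPositiveMap_exists_eq_sum Ψ hM
    refine cstarMatrix_nonneg_of_eq_sum
      (fun (l : Fin k × m) j => ∑ q, v q • Y l.1 j l.2 q) fun i j => ?_
    simp only [CStarMatrix.map_apply, LinearMap.coe_mk, AddHom.coe_mk, hY, cstarMatrix_sum_apply,
      CStarMatrix.mul_apply, CStarMatrix.star_apply, Fintype.sum_prod_type, star_sum, star_smul,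
      Finset.sum_mul, Finset.mul_sum, smul_mul_smul_comm, Finset.smul_sum]
    rw [Finset.sum_comm_cycle]
    refine Finset.sum_congr rfl fun k _ => ?_
    rw [Finset.sum_comm_cycle]
    exact Finset.sum_congr rfl fun r _ => Finset.sum_comm

theorem compress_apply {m : Type*} [Fintype m] (Ψ : A →CP CStarMatrix m m B) (v : m → ℂ) (a : A) :
    compress Ψ v a = ∑ p, ∑ q, (star (v p) * v q) • Ψ a p q := rfl

theorem completelyPositiveMap_coe_apply (π : A →⋆ₙₐ[ℂ] B) (a : A) : (π : A →CP B) a = π a := rfl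

theorem exists_polarization (Ψ : A →CP CStarMatrix (Fin 2) (Fin 2) B) :
    ∃ φ₁ φ₂ φ₃ φ₄ : A →CP B,
      ∀ a, Ψ a 1 0 = φ₁ a - φ₂ a + Complex.I • (φ₃ a - φ₄ a) := by
  refine ⟨compress Ψ ![1 / 2, 1 / 2], compress Ψ ![1 / 2, -1 / 2],
    compress Ψ ![1 / 2, Complex.I / 2], compress Ψ ![1 / 2, -Complex.I / 2], fun a => ?_⟩
  simp only [compress_apply, Fin.sum_univ_two, Matrix.cons_val_zero, Matrix.cons_val_one,
    RCLike.star_def, map_div₀, map_neg, map_one, map_ofNat, Complex.conj_I]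
  match_scalars <;> ring_nf <;> simp; norm_num

theorem exists_matrix_of_eq_sum {ι : Type*} [Fintype ι] {φ : A → B} {ψ : ι → (A →CP B)}
    {T S : ι → B} (h : ∀ a, φ a = ∑ i, star (T i) * ψ i a * S i) :
    ∃ (φ₁ φ₂ : A →CP B) (Ψ : A →CP CStarMatrix (Fin 2) (Fin 2) B),
      ∀ a, Ψ a = CStarMatrix.ofMatrix !![φ₁ a, star (φ (star a)); φ a, φ₂ a] := by
  let Ψ := conjSum (m := Fin 2) ψ fun i => ![S i, T i]
  have map_eq (a : A) : φ a = Ψ a 1 0 := by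
    simp only [h, Ψ, conjSum_apply, mul_assoc]
    rfl
  have star_map_star (a : A) : star (φ (star a)) = Ψ a 0 1 := by
    simp only [h, Ψ, conjSum_apply, star_sum, star_mul, star_star, completelyPositiveMap_map_star]
    rfl
  refine ⟨compress Ψ ![1, 0], compress Ψ ![0, 1], Ψ, fun a => ?_⟩
  ext p q
  rw [star_map_star, map_eq]
  fin_cases p <;> fin_cases q <;> simp [compress_apply, Fin.sum_univ_two]

end CompletelyPositive

/-! ### Matrices of operators -/

section OperatorMatrices

open scoped ComplexOrder InnerProductSpace

variable {H : Type*} [NormedAddCommGroup H] [InnerProductSpace ℂ H] [CompleteSpace H]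
  {n κ : Type*} [Fintype n] [Fintype κ]

theorem sum_inner_star_mul (Y : κ → n → H →L[ℂ] H) (h : n → H) :
    ∑ i, ∑ j, ⟪h i, (∑ k, star (Y k i) * Y k j) (h j)⟫_ℂ =
      ((∑ k, ‖∑ j, Y k j (h j)‖ ^ 2 : ℝ) : ℂ) := by
  have norm_sq (k : κ) : ((‖∑ j, Y k j (h j)‖ ^ 2 : ℝ) : ℂ) =
      ∑ i, ∑ j, ⟪h i, (star (Y k i) * Y k j) (h j)⟫_ℂ := by
    rw [Complex.ofReal_pow]
    refine (inner_self_eq_norm_sq_to_K (𝕜 := ℂ) (∑ j, Y k j (h j))).symm.trans ?_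
    simp only [inner_sum, sum_inner, mul_apply_eq_comp, ContinuousLinearMap.star_eq_adjoint,
      ContinuousLinearMap.adjoint_inner_right]
    exact Finset.sum_comm
  rw [Complex.ofReal_sum]
  simp only [norm_sq, sum_apply, inner_sum]
  rw [Finset.sum_comm_cycle]

theorem sum_inner_nonneg {Y : κ → n → H →L[ℂ] H} {T : n → n → H →L[ℂ] H}
    (hT : ∀ i j, T i j = ∑ k, star (Y k i) * Y k j) (h : n → H) :
    0 ≤ ∑ i, ∑ j, ⟪h i, T i j (h j)⟫_ℂ := by
  simp only [hT]
  rw [sum_inner_star_mul, Complex.zero_le_real]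
  positivity

theorem star_mul_self_le_norm_sq_smul_one {D : Type*} [CStarAlgebra D] [PartialOrder D]
    [StarOrderedRing D] (x : D) : star x * x ≤ ((‖x‖ ^ 2 : ℝ) : ℂ) • (1 : D) := by
  rw [Complex.coe_smul, ← Algebra.algebraMap_eq_smul_one]
  exact CStarAlgebra.star_mul_le_algebraMap_norm_sq

theorem sum_norm_sq_le_norm_sq_mul (T : CStarMatrix n n (H →L[ℂ] H)) (h : n → H) :
    ∑ i, ‖∑ j, T i j (h j)‖ ^ 2 ≤ ‖T‖ ^ 2 * ∑ i, ‖h i‖ ^ 2 := by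
  classical
  obtain ⟨Y, hY⟩ := exists_eq_sum_of_cstarMatrix_nonneg
    (sub_nonneg.mpr (star_mul_self_le_norm_sq_smul_one T))
  have sum_inner_star_mul_self := sum_inner_star_mul (fun k i => T k i) h
  have sum_inner_smul_one : ∑ i, ∑ j, ⟪h i, (((‖T‖ ^ 2 : ℝ) : ℂ) •
      (1 : CStarMatrix n n (H →L[ℂ] H))) i j (h j)⟫_ℂ = ((‖T‖ ^ 2 * ∑ i, ‖h i‖ ^ 2 : ℝ) : ℂ) := by
    push_cast
    rw [Finset.mul_sum]
    refine Finset.sum_congr rfl fun i _ => ?_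
    rw [Finset.sum_eq_single i (fun j _ hj => by simp [CStarMatrix.one_apply_ne hj.symm]) (by simp)]
    simp
  have sub_nonneg := sum_inner_nonneg hY h
  simp only [CStarMatrix.sub_apply, sub_apply, inner_sub_right, Finset.sum_sub_distrib,
    sum_inner_smul_one] at sub_nonneg
  simp only [CStarMatrix.mul_apply, CStarMatrix.star_apply] at sub_nonneg
  rw [sum_inner_star_mul_self, ← Complex.ofReal_sub, Complex.zero_le_real] at sub_nonneg
  linarith

end OperatorMatrices

/-! ### Similarity to a ⋆-homomorphism -/

section Similarity

variable {A D : Type*} [NonUnitalCStarAlgebra A] [CStarAlgebra D]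

/-- The homomorphism `φ` into `D` is similar to a ⋆-homomorphism by means of an invertible element
of `D`. -/
def IsSimilarToStarHom (φ : A →ₙₐ[ℂ] D) : Prop :=
  ∃ (S : Dˣ) (π : A →⋆ₙₐ[ℂ] D), ∀ a, π a = (S : D) * φ a * ((S⁻¹ : Dˣ) : D)

/-- The homomorphism `a ↦ S φ(a) S⁻¹`. -/
def conjHom (φ : A →ₙₐ[ℂ] D) (S : Dˣ) : A →ₙₐ[ℂ] D where
  toFun a := S * φ a * ↑S⁻¹
  map_smul' c a := by simp
  map_zero' := by simp
  map_add' a b := by simp [mul_add, add_mul]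
  map_mul' a b := by simp [mul_assoc]

theorem conjHom_apply (φ : A →ₙₐ[ℂ] D) (S : Dˣ) (a : A) : conjHom φ S a = S * φ a * ↑S⁻¹ := rfl

variable [PartialOrder D] [StarOrderedRing D]

theorem exists_eq_conj_of_isStrictlyPositive {φ : A →ₙₐ[ℂ] D} {P : D} (hP : IsStrictlyPositive P)
    (h : ∀ a, φ a * P = P * star (φ (star a))) :
    ∃ (T : Dˣ) (π : A →⋆ₙₐ[ℂ] D), 0 ≤ (T : D) ∧ ∀ a, φ a = T * π a * ↑T⁻¹ := by
  obtain ⟨u, hu⟩ := hP.isUnit_cfcSqrt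
  have u_mul_u : (u : D) * u = P := hu ▸ CFC.sqrt_mul_sqrt_self P hP.nonneg
  have u_nonneg : 0 ≤ (u : D) := hu ▸ CFC.sqrt_nonneg P
  have star_u : star (u : D) = u := (IsSelfAdjoint.of_nonneg u_nonneg).star_eq
  have star_u_inv : star ((u⁻¹ : Dˣ) : D) = ((u⁻¹ : Dˣ) : D) := by
    rw [← Units.coe_star_inv, show star u = u from Units.ext star_u]
  have map_star (a : A) : conjHom φ u⁻¹ (star a) = star (conjHom φ u⁻¹ a) := by
    have : φ (star a) * (u * u) = u * u * star (φ a) := by simpa [u_mul_u] using h (star a)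
    rw [conjHom_apply, conjHom_apply, inv_inv, star_mul, star_mul, star_u, star_u_inv, mul_assoc,
      Units.inv_mul_eq_iff_eq_mul, ← mul_assoc, ← mul_assoc, Units.eq_mul_inv_iff_mul_eq,
      mul_assoc, this]
  refine ⟨u, { conjHom φ u⁻¹ with map_star' := map_star }, u_nonneg, fun a => ?_⟩
  change φ a = u * (conjHom φ u⁻¹ a) * ↑u⁻¹
  simp [conjHom_apply, ← mul_assoc]

theorem isSimilarToStarHom_of_isStrictlyPositive {φ : A →ₙₐ[ℂ] D} {P : D}
    (hP : IsStrictlyPositive P) (h : ∀ a, φ a * P = P * star (φ (star a))) :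
    IsSimilarToStarHom φ := by
  obtain ⟨T, π, -, hT⟩ := exists_eq_conj_of_isStrictlyPositive hP h
  exact ⟨T⁻¹, π, fun a => by simp [hT, ← mul_assoc]⟩

theorem IsSimilarToStarHom.exists_eq_conj_nonneg {φ : A →ₙₐ[ℂ] D} (hφ : IsSimilarToStarHom φ) :
    ∃ (T : Dˣ) (π : A →⋆ₙₐ[ℂ] D), 0 ≤ (T : D) ∧ ∀ a, φ a = T * π a * ↑T⁻¹ := by
  obtain ⟨S, π, h⟩ := hφ
  have φ_eq (a : A) : φ a = ↑S⁻¹ * π a * S := by simp [h, ← mul_assoc]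
  have star_inv_mul_star : star ((S⁻¹ : Dˣ) : D) * star (S : D) = 1 := by
    rw [← star_mul, S.mul_inv, star_one]
  refine exists_eq_conj_of_isStrictlyPositive (P := ↑S⁻¹ * star ((S⁻¹ : Dˣ) : D))
    (IsUnit.isStrictlyPositive (S⁻¹.isUnit.mul S⁻¹.isUnit.star) (mul_star_self_nonneg _))
    fun a => ?_
  calc φ a * (↑S⁻¹ * star ((S⁻¹ : Dˣ) : D))
      = ↑S⁻¹ * π a * star ((S⁻¹ : Dˣ) : D) := by simp [φ_eq, mul_assoc]
    _ = ↑S⁻¹ * (star ((S⁻¹ : Dˣ) : D) * star (S : D)) * π a * star ((S⁻¹ : Dˣ) : D) := by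
      rw [star_inv_mul_star, mul_one]
    _ = ↑S⁻¹ * star ((S⁻¹ : Dˣ) : D) * star (φ (star a)) := by
      simp only [φ_eq, star_mul, ← map_star, star_star, mul_assoc]

theorem IsSimilarToStarHom.exists_eq_star_mul_mul [PartialOrder A] [StarOrderedRing A]
    {φ : A →ₙₐ[ℂ] D} (hφ : IsSimilarToStarHom φ) :
    ∃ (ψ : A →CP D) (T S : D), ∀ a, φ a = star T * ψ a * S := by
  obtain ⟨T, π, -, h⟩ := hφ.exists_eq_conj_nonneg
  exact ⟨(π : A →CP D), star (T : D), ↑T⁻¹, fun a => by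
    rw [h, star_star, completelyPositiveMap_coe_apply]⟩

end Similarity

/-! ### The support idempotent of a representation -/

section Support

open scoped InnerProductSpace
open Filter Topology ContinuousLinearMapWOT

variable {H : Type*} [NormedAddCommGroup H] [InnerProductSpace ℂ H]

theorem exists_tendsto_ofCLM_of_norm_le [CompleteSpace H] {ι : Type*} (U : Ultrafilter ι)
    {T : ι → H →L[ℂ] H} {C : ℝ} (hT : ∀ᶠ i in U, ‖T i‖ ≤ C) :
    ∃ E : H →L[ℂ] H, Tendsto (fun i => ofCLM (T i)) U (𝓝 (ofCLM E)) := by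
  have norm_inner_le (k h : H) : ∀ᶠ i in U, ‖⟪k, T i h⟫_ℂ‖ ≤ C * ‖k‖ * ‖h‖ := by
    filter_upwards [hT] with i hi
    calc ‖⟪k, T i h⟫_ℂ‖ ≤ ‖k‖ * ‖T i h‖ := norm_inner_le_norm _ _
      _ ≤ ‖k‖ * (C * ‖h‖) := by gcongr; exact (T i).le_of_opNorm_le hi h
      _ = _ := by ring
  have exists_lim (k h : H) : ∃ z : ℂ, Tendsto (fun i => ⟪k, T i h⟫_ℂ) U (𝓝 z) := by
    obtain ⟨z, -, hz⟩ := (isCompact_closedBall (0 : ℂ) (C * ‖k‖ * ‖h‖)).ultrafilter_le_nhds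
      (U.map fun i => ⟪k, T i h⟫_ℂ) (by
        rw [le_principal_iff, Ultrafilter.mem_coe, Ultrafilter.mem_map]
        filter_upwards [norm_inner_le k h] with i hi
        simpa using hi)
    exact ⟨z, hz⟩
  choose b hb using exists_lim
  let B : H →ₗ⋆[ℂ] H →ₗ[ℂ] ℂ := LinearMap.mk₂'ₛₗ (starRingEnd ℂ) (RingHom.id ℂ) b
    (fun k k' h => tendsto_nhds_unique (hb _ _)
      (by simpa [inner_add_left] using (hb k h).add (hb k' h)))
    (fun c k h => tendsto_nhds_unique (hb _ _)
      (by simpa [inner_smul_left, mul_comm] using (hb k h).const_mul ((starRingEnd ℂ) c)))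
    (fun k h h' => tendsto_nhds_unique (hb _ _)
      (by simpa [inner_add_right] using (hb k h).add (hb k h')))
    (fun c k h => tendsto_nhds_unique (hb _ _)
      (by simpa [inner_smul_right] using (hb k h).const_mul c))
  let B' : H →L⋆[ℂ] H →L[ℂ] ℂ := B.mkContinuous₂ C fun k h =>
    le_of_tendsto (hb k h).norm (norm_inner_le k h)
  refine ⟨(InnerProductSpace.continuousLinearMapOfBilin B').adjoint,
    tendsto_iff_forall_inner_apply_tendsto.mpr fun h k => ?_⟩
  rw [ofCLM_apply, ContinuousLinearMap.adjoint_inner_right,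
    InnerProductSpace.continuousLinearMapOfBilin_apply]
  exact hb k h

variable {A : Type*} [NonUnitalCStarAlgebra A]

/-- `E` is a two-sided identity for the range of `φ`, and it is the limit of `φ` in the weak
operator topology along the filter `l`, which is carried by the closed unit ball. -/
structure IsSupport (φ : A →ₙₐ[ℂ] H →L[ℂ] H) (l : Filter A) (E : H →L[ℂ] H) : Prop where
  neBot : l.NeBot
  eventually_norm_le : ∀ᶠ e in l, ‖e‖ ≤ 1
  tendsto : Tendsto (fun e => ofCLM (φ e)) l (𝓝 (ofCLM E))
  support_mul : ∀ a, E * φ a = φ a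
  mul_support : ∀ a, φ a * E = φ a

namespace IsSupport

variable {φ : A →ₙₐ[ℂ] H →L[ℂ] H} {l : Filter A} {E : H →L[ℂ] H}

theorem mul_eq_mul (h : IsSupport φ l E) {X Y : H →L[ℂ] H} (hXY : ∀ a, X * φ a = φ a * Y) :
    X * E = E * Y := by
  have := h.neBot
  apply ofCLM_injective
  refine tendsto_nhds_unique (h.tendsto.const_mul (ofCLM X)) ?_
  simp only [← ofCLM_mul, hXY]
  exact h.tendsto.mul_const (ofCLM Y)

theorem mul_self (h : IsSupport φ l E) : E * E = E := by
  simpa using h.mul_eq_mul (X := E) (Y := 1) fun a => by simp [h.support_mul]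

theorem mul_eq_zero (h : IsSupport φ l E) {X : H →L[ℂ] H} (hX : ∀ a, φ a * X = 0) : E * X = 0 := by
  simpa using (h.mul_eq_mul (X := 0) (Y := X) fun a => by simp [hX]).symm

end IsSupport

theorem exists_isSupport [CompleteSpace H] [PartialOrder A] [StarOrderedRing A]
    {φ : A →ₙₐ[ℂ] H →L[ℂ] H} {C : ℝ} (hφ : ∀ a, ‖φ a‖ ≤ C * ‖a‖) : ∃ l E, IsSupport φ l E := by
  have approxUnit := CStarAlgebra.increasingApproximateUnit A
  let U : Ultrafilter A := Ultrafilter.of (CStarAlgebra.approximateUnit A)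
  have U_le : (U : Filter A) ≤ CStarAlgebra.approximateUnit A := Ultrafilter.of_le _
  have eventually_norm_le : ∀ᶠ e in (U : Filter A), ‖e‖ ≤ 1 :=
    approxUnit.eventually_norm.filter_mono U_le
  obtain ⟨E, hE⟩ := exists_tendsto_ofCLM_of_norm_le U (T := φ) (C := |C|) (by
    filter_upwards [eventually_norm_le] with e he
    calc ‖φ e‖ ≤ C * ‖e‖ := hφ e
      _ ≤ |C| * 1 := by gcongr; exact le_abs_self C
      _ = |C| := mul_one _)
  have continuous_map : Continuous fun a => ofCLM (φ a) :=
    continuous_ofCLM.comp (AddMonoidHomClass.continuous_of_bound φ C hφ)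
  refine ⟨U, E, U.neBot, eventually_norm_le, hE, fun a => ?_, fun a => ?_⟩
  · refine ofCLM_injective (tendsto_nhds_unique (hE.mul_const (ofCLM (φ a))) ?_)
    refine ((continuous_map.tendsto a).comp
      ((approxUnit.tendsto_mul_right a).mono_left U_le)).congr fun e => ?_
    simp
  · refine ofCLM_injective (tendsto_nhds_unique (hE.const_mul (ofCLM (φ a))) ?_)
    refine ((continuous_map.tendsto a).comp
      ((approxUnit.tendsto_mul_left a).mono_left U_le)).congr fun e => ?_
    simp

variable [CompleteSpace H] {M : VonNeumannAlgebra H}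

theorem mem_of_forall_commutant {z : H →L[ℂ] H} (h : ∀ x ∈ M.commutant, x * z = z * x) : z ∈ M := by
  rwa [← M.commutant_commutant, VonNeumannAlgebra.mem_commutant_iff]

theorem commute_of_mem_commutant {z x : H →L[ℂ] H} (hz : z ∈ M) (hx : x ∈ M.commutant) :
    x * z = z * x :=
  (VonNeumannAlgebra.mem_commutant_iff.mp hx z hz).symm

/-- The homomorphism `φ` into `M`, viewed as a representation on the Hilbert space on which `M`
acts. -/
def toRepresentation (φ : A →ₙₐ[ℂ] M) : A →ₙₐ[ℂ] H →L[ℂ] H where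
  toFun a := φ a
  map_smul' c a := by rw [map_smul]; rfl
  map_zero' := by rw [map_zero]; rfl
  map_add' a b := by rw [map_add]; rfl
  map_mul' a b := by rw [map_mul]; rfl

theorem toRepresentation_apply (φ : A →ₙₐ[ℂ] M) (a : A) : toRepresentation φ a = φ a := rfl

theorem IsSupport.mem {φ : A →ₙₐ[ℂ] M} {l : Filter A} {E : H →L[ℂ] H}
    (h : IsSupport (toRepresentation φ) l E) : E ∈ M :=
  mem_of_forall_commutant fun _ hx => h.mul_eq_mul fun a => commute_of_mem_commutant (φ a).2 hx

end Support

/-! ### Similarities from intertwining operators -/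

section Intertwining

open scoped InnerProductSpace

/-- The element `E N E⋆ + (1 - E) (1 - E)⋆`, which is invertible if `E` is idempotent and `N` is
bounded below by a positive multiple of `E E⋆`. -/
def supportedPart {R : Type*} [Ring R] [StarRing R] (E N : R) : R :=
  E * N * star E + (1 - E) * star (1 - E)

theorem mul_supportedPart {R : Type*} [Ring R] [StarRing R] {E N x y : R}
    (hEx : E * x = x) (hxE : x * E = x) (hEy : E * star y = star y) (hyE : star y * E = star y)
    (hxy : x * N = N * y) : x * supportedPart E N = supportedPart E N * y := by
  have star_mul_y : star E * y = y := by simpa using congrArg star hyE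
  have y_mul_star : y * star E = y := by simpa using congrArg star hEy
  have mul_compression : x * (E * N * star E) = N * y := by
    rw [← mul_assoc, ← mul_assoc, hxE, hxy, mul_assoc, y_mul_star]
  have compression_mul : E * N * star E * y = N * y := by
    rw [mul_assoc, star_mul_y, mul_assoc, ← hxy, ← mul_assoc, hEx]
  rw [supportedPart, mul_add, add_mul, mul_compression, compression_mul, ← mul_assoc, mul_sub, hxE,
    mul_assoc (1 - E), star_sub, sub_mul (star 1), star_mul_y]
  simp

theorem exists_algebraMap_le_supportedPart {D : Type*} [CStarAlgebra D] [PartialOrder D]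
    [StarOrderedRing D] {E N : D} {c : ℝ} (hE : E * E = E) (hc : 0 < c)
    (hN : c • (E * star E) ≤ N) :
    ∃ r : ℝ, 0 < r ∧ algebraMap ℝ D r ≤ supportedPart E N := by
  refine ⟨min c 1 / 2, by positivity, ?_⟩
  have parallelogram : (2 : ℝ) • (E * star E + (1 - E) * star (1 - E)) =
      1 + (E - (1 - E)) * star (E - (1 - E)) := by
    simp only [star_sub, star_one, two_smul]
    noncomm_ring
  have conj_mul_star : E * (E * star E) * star E = E * star E := by
    rw [← mul_assoc, hE, mul_assoc, ← star_mul, hE]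
  calc algebraMap ℝ D (min c 1 / 2) = (min c 1 / 2) • (1 : D) := Algebra.algebraMap_eq_smul_one _
    _ ≤ (min c 1 / 2) • ((2 : ℝ) • (E * star E + (1 - E) * star (1 - E))) := by
      refine smul_le_smul_of_nonneg_left ?_ (by positivity)
      rw [parallelogram]
      exact le_add_of_nonneg_right (mul_star_self_nonneg _)
    _ = min c 1 • (E * star E) + min c 1 • ((1 - E) * star (1 - E)) := by
      rw [smul_smul, div_mul_cancel₀ _ two_ne_zero, smul_add]
    _ ≤ c • (E * star E) + (1 : ℝ) • ((1 - E) * star (1 - E)) := by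
      gcongr
      · exact mul_star_self_nonneg E
      · exact min_le_left c 1
      · exact mul_star_self_nonneg (1 - E)
      · exact min_le_right c 1
    _ = E * (c • (E * star E)) * star E + (1 - E) * star (1 - E) := by
      rw [mul_smul_comm, smul_mul_assoc, conj_mul_star, one_smul]
    _ ≤ supportedPart E N := by
      have := star_right_conjugate_le_conjugate hN E
      exact add_le_add_left this _

variable {H : Type*} [NormedAddCommGroup H] [InnerProductSpace ℂ H] [CompleteSpace H]
  {M : VonNeumannAlgebra H}

theorem smul_mul_star_self_le {E N : H →L[ℂ] H} {c : ℝ} (hN : 0 ≤ N)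
    (h : ∀ k, c * ‖star E k‖ ^ 2 ≤ RCLike.re ⟪k, N k⟫_ℂ) : c • (E * star E) ≤ N := by
  rw [← sub_nonneg, ContinuousLinearMap.nonneg_iff_isPositive, ContinuousLinearMap.isPositive_def']
  refine ⟨(IsSelfAdjoint.of_nonneg hN).sub ((IsSelfAdjoint.all c).smul (.mul_star_self E)),
    fun k => ?_⟩
  have re_inner_self : RCLike.re ⟪(c • (E * star E)) k, k⟫_ℂ = c * ‖star E k‖ ^ 2 := by
    rw [smul_apply, mul_apply_eq_comp, ← Complex.coe_smul, inner_smul_left,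
      Complex.conj_ofReal, ← ContinuousLinearMap.adjoint_inner_right,
      ← ContinuousLinearMap.star_eq_adjoint]
    exact (RCLike.re_ofReal_mul _ _).trans (congrArg (c * ·) (inner_self_eq_norm_sq _))
  rw [ContinuousLinearMap.reApplyInnerSelf_apply, sub_apply, inner_sub_left, map_sub,
    re_inner_self, inner_re_symm]
  linarith [h k]

theorem supportedPart_mem {E N : H →L[ℂ] H} (hE : E ∈ M)
    (hN : ∀ x ∈ M.commutant, E * (x * N - N * x) = 0) : supportedPart E N ∈ M := by
  refine add_mem (mem_of_forall_commutant fun x hx => ?_)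
    (mul_mem (sub_mem (one_mem _) hE) (star_mem (sub_mem (one_mem _) hE)))
  have commute_left : E * (x * N) = E * (N * x) := by rw [← sub_eq_zero, ← mul_sub, hN x hx]
  calc x * (E * N * star E) = (x * E) * N * star E := by simp only [mul_assoc]
    _ = E * (x * N) * star E := by rw [commute_of_mem_commutant hE hx]; simp only [mul_assoc]
    _ = E * N * (x * star E) := by rw [commute_left]; simp only [mul_assoc]
    _ = E * N * star E * x := by
      rw [commute_of_mem_commutant (star_mem hE) hx]; simp only [mul_assoc]

variable {A : Type*} [NonUnitalCStarAlgebra A]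

theorem isSimilarToStarHom_of_intertwining {φ : A →ₙₐ[ℂ] M} {l : Filter A} {E N : H →L[ℂ] H}
    {c : ℝ} (hE : IsSupport (toRepresentation φ) l E) (hc : 0 < c) (hEN : c • (E * star E) ≤ N)
    (hφN : ∀ a, (φ a : H →L[ℂ] H) * N = N * star (φ (star a) : H →L[ℂ] H))
    (hcomm : ∀ a, ∀ x ∈ M.commutant, (φ a : H →L[ℂ] H) * (x * N - N * x) = 0) :
    IsSimilarToStarHom φ := by
  have mem := supportedPart_mem hE.mem fun x hx => hE.mul_eq_zero fun a => hcomm a x hx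
  obtain ⟨r, hr, r_le⟩ := exists_algebraMap_le_supportedPart hE.mul_self hc hEN
  have r_le' : algebraMap ℝ M r ≤ ⟨supportedPart E N, mem⟩ := r_le
  refine isSimilarToStarHom_of_isStrictlyPositive
    (.of_le (isStrictlyPositive_algebraMap hr) r_le') fun a => Subtype.ext ?_
  exact mul_supportedPart (hE.support_mul a) (hE.mul_support a)
    (by simpa [toRepresentation_apply] using hE.support_mul (star a))
    (by simpa [toRepresentation_apply] using hE.mul_support (star a)) (hφN a)

end Intertwining

/-! ### Similarities from completely positive `2 × 2` matrices -/

section Evaluation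

open scoped InnerProductSpace ComplexOrder

variable {H : Type*} [NormedAddCommGroup H] [InnerProductSpace ℂ H]

/-- The evaluation map `b ⊗ h ↦ Φ(b) h`. -/
def evalTensor {B : Type*} [AddCommGroup B] [Module ℂ B] (Φ : B →ₗ[ℂ] H →L[ℂ] H) :
    B ⊗[ℂ] H →ₗ[ℂ] H :=
  TensorProduct.lift <| LinearMap.mk₂ ℂ (fun b h => Φ b h) (by simp) (by simp) (by simp) (by simp)

@[simp]
theorem evalTensor_tmul {B : Type*} [AddCommGroup B] [Module ℂ B] (Φ : B →ₗ[ℂ] H →L[ℂ] H) (b : B)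
    (h : H) : evalTensor Φ (b ⊗ₜ h) = Φ b h := rfl

theorem evalTensor_lTensor {B : Type*} [AddCommGroup B] [Module ℂ B] {Φ : B →ₗ[ℂ] H →L[ℂ] H}
    {x : H →L[ℂ] H} (hx : ∀ b, x * Φ b = Φ b * x) (ξ : B ⊗[ℂ] H) :
    evalTensor Φ (LinearMap.lTensor B (x : H →ₗ[ℂ] H) ξ) = x (evalTensor Φ ξ) := by
  have : evalTensor Φ ∘ₗ LinearMap.lTensor B (x : H →ₗ[ℂ] H) = (x : H →ₗ[ℂ] H) ∘ₗ evalTensor Φ :=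
    TensorProduct.ext' fun b h => congrArg (· h) (hx b).symm
  exact LinearMap.congr_fun this ξ

theorem re_inner_apply_self_le {T : H →L[ℂ] H} {C : ℝ} (hT : ‖T‖ ≤ C) (h : H) :
    (⟪h, T h⟫_ℂ).re ≤ C * ‖h‖ ^ 2 :=
  calc (⟪h, T h⟫_ℂ).re ≤ ‖h‖ * ‖T h‖ := (Complex.re_le_norm _).trans (norm_inner_le_norm _ _)
    _ ≤ ‖h‖ * (C * ‖h‖) := by
        gcongr
        exact T.le_of_opNorm_le hT h
    _ = C * ‖h‖ ^ 2 := by ring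

variable {B : Type*} [NonUnitalCStarAlgebra B]

theorem evalTensor_leftMul (Φ : B →ₙₐ[ℂ] H →L[ℂ] H) (b : B) (ξ : B ⊗[ℂ] H) :
    evalTensor (Φ : B →ₗ[ℂ] H →L[ℂ] H) (leftMul H b ξ) =
      Φ b (evalTensor (Φ : B →ₗ[ℂ] H →L[ℂ] H) ξ) := by
  have : evalTensor (Φ : B →ₗ[ℂ] H →L[ℂ] H) ∘ₗ leftMul H b =
      (Φ b : H →ₗ[ℂ] H) ∘ₗ evalTensor (Φ : B →ₗ[ℂ] H →L[ℂ] H) :=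
    TensorProduct.ext' fun a h => congrArg (· h) (map_mul Φ b a)
  exact LinearMap.congr_fun this ξ

theorem IsSupport.evalTensor_eq {φ : B →ₙₐ[ℂ] H →L[ℂ] H} {l : Filter B} {E : H →L[ℂ] H}
    (h : IsSupport φ l E) (ξ : B ⊗[ℂ] H) :
    E (evalTensor (φ : B →ₗ[ℂ] H →L[ℂ] H) ξ) = evalTensor (φ : B →ₗ[ℂ] H →L[ℂ] H) ξ := by
  have : (E : H →ₗ[ℂ] H) ∘ₗ evalTensor (φ : B →ₗ[ℂ] H →L[ℂ] H) =
      evalTensor (φ : B →ₗ[ℂ] H →L[ℂ] H) :=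
    TensorProduct.ext' fun a k => congrArg (· k) (h.support_mul a)
  exact LinearMap.congr_fun this ξ

open Filter Topology ContinuousLinearMapWOT in
theorem IsSupport.norm_inner_sq_le [CompleteSpace H] {φ : B →ₙₐ[ℂ] H →L[ℂ] H} {l : Filter B}
    {E : H →L[ℂ] H} (hE : IsSupport φ l E) {g h : H} {c : ℝ}
    (hc : ∀ e, ‖e‖ ≤ 1 → ‖⟪g, φ e h⟫_ℂ‖ ^ 2 ≤ c) : ‖⟪g, E h⟫_ℂ‖ ^ 2 ≤ c := by
  have := hE.neBot
  have tendsto_inner : Tendsto (fun e => ⟪g, φ e h⟫_ℂ) l (𝓝 ⟪g, E h⟫_ℂ) :=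
    tendsto_iff_forall_inner_apply_tendsto.mp hE.tendsto h g
  refine le_of_tendsto (tendsto_inner.norm.pow 2) ?_
  filter_upwards [hE.eventually_norm_le] with e he using hc e he

theorem IsSupport.norm_evalTensor_sq_le [CompleteSpace H] {φ : B →ₙₐ[ℂ] H →L[ℂ] H} {l : Filter B}
    {E : H →L[ℂ] H} (hE : IsSupport φ l E) {ξ : B ⊗[ℂ] H} {c : ℝ} (hc : 0 ≤ c)
    (h : ∀ e, ‖e‖ ≤ 1 → ∀ g,
      ‖⟪g, φ e (evalTensor (φ : B →ₗ[ℂ] H →L[ℂ] H) ξ)⟫_ℂ‖ ^ 2 ≤ c * ‖g‖ ^ 2) :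
    ‖evalTensor (φ : B →ₗ[ℂ] H →L[ℂ] H) ξ‖ ^ 2 ≤ c := by
  set q := evalTensor (φ : B →ₗ[ℂ] H →L[ℂ] H) ξ with hq
  have inner_self : ⟪q, E q⟫_ℂ = ((‖q‖ ^ 2 : ℝ) : ℂ) := by
    rw [hq, hE.evalTensor_eq, Complex.ofReal_pow]
    exact inner_self_eq_norm_sq_to_K _
  apply le_of_sq_le_mul_self hc
  calc (‖q‖ ^ 2) ^ 2 = ‖⟪q, E q⟫_ℂ‖ ^ 2 := by simp [inner_self]
    _ ≤ c * ‖q‖ ^ 2 := hE.norm_inner_sq_le fun e he => h e he q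

variable [CompleteSpace H] {t : B →ₗ[ℂ] H →ₗ⋆[ℂ] H →ₗ[ℂ] ℂ} {N : H →L[ℂ] H}

theorem IsPushforward.map_mul_eq_mul_star {Φ : B →ₙₐ[ℂ] H →L[ℂ] H}
    {s : B ⊗[ℂ] H →ₗ⋆[ℂ] B ⊗[ℂ] H →ₗ[ℂ] ℂ}
    (hN : IsPushforward s (evalTensor (Φ : B →ₗ[ℂ] H →L[ℂ] H)) N) (hs : s.IsNonneg)
    (hadj : ∀ c ξ η, s (leftMul H c ξ) η = s ξ (leftMul H (star c) η)) (b : B) :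
    Φ b * N = N * star (Φ (star b)) :=
  hN.mul_eq_mul_star (isFormBounded_leftMul hs hadj b) (isFormBounded_leftMul hs hadj (star b))
    (hadj b) (evalTensor_leftMul Φ b) (evalTensor_leftMul Φ (star b))

theorem IsPushforward.commute_of_mem {Φ : B →ₗ[ℂ] H →L[ℂ] H} {R : VonNeumannAlgebra H}
    (hN : IsPushforward (kernelForm t) (evalTensor Φ) N)
    (ht : ∀ x ∈ R, ∀ b k h, t b (x k) h = t b k (star x h))
    (hΦ : ∀ x ∈ R, ∀ b, x * Φ b = Φ b * x) {x : H →L[ℂ] H} (hx : x ∈ R) : x * N = N * x := by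
  let L (y : H →L[ℂ] H) : B ⊗[ℂ] H →ₗ[ℂ] B ⊗[ℂ] H := LinearMap.lTensor B (y : H →ₗ[ℂ] H)
  have adjoint {y} (hy : y ∈ R) (ξ η) : kernelForm t (L y ξ) η = kernelForm t ξ (L (star y) η) := by
    simpa [L] using kernelForm_lTensor (v := LinearMap.id) (ht y hy) ξ η
  have L_mul (y z ξ) : L y (L z ξ) = L (y * z) ξ :=
    (LinearMap.lTensor_comp_apply B (y : H →ₗ[ℂ] H) (z : H →ₗ[ℂ] H) ξ).symm
  have L_one (ξ) : L 1 ξ = ξ := LinearMap.lTensor_id_apply B H ξ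
  have isFormBounded (u : R) (hu : u ∈ unitary R) : IsFormBounded (kernelForm t) (L u) := by
    have star_mul_self : star (u : H →L[ℂ] H) * u = 1 := congrArg Subtype.val hu.1
    exact ⟨1, zero_le_one, fun ξ => by
      rw [adjoint u.2, L_mul, star_mul_self, one_mul, L_one]⟩
  have span_unitary : (⟨x, hx⟩ : R) ∈ Submodule.span ℂ (unitary R : Set R) := by
    rw [CStarAlgebra.span_unitary]
    trivial
  suffices ∀ y : R, y ∈ Submodule.span ℂ (unitary R : Set R) → (y : H →L[ℂ] H) * N = N * y from
    this _ span_unitary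
  intro y hy
  induction hy using Submodule.span_induction with
  | mem u hu =>
    simpa using hN.mul_eq_mul_star (isFormBounded u hu)
      (isFormBounded (star u) (Unitary.star_mem hu)) (adjoint u.2) (evalTensor_lTensor (hΦ u u.2))
      (evalTensor_lTensor (hΦ (star u) (star_mem u.2)))
  | zero => simp
  | add y z _ _ hy hz => simp [add_mul, mul_add, hy, hz]
  | smul c y _ hy =>
    change (c • (y : H →L[ℂ] H)) * N = N * (c • (y : H →L[ℂ] H))
    rw [smul_mul_assoc, mul_smul_comm, hy]

theorem IsPushforward.norm_star_support_sq_le {φ : B →ₙₐ[ℂ] H →L[ℂ] H} {l : Filter B}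
    {E : H →L[ℂ] H} {C : ℝ} (hN : IsPushforward (kernelForm t) (evalTensor (φ : B →ₗ[ℂ] _)) N)
    (hE : IsSupport φ l E) (hC : 0 ≤ C)
    (ht : ∀ e, ‖e‖ ≤ 1 → ∀ h, (t (star e * e) h h).re ≤ C * ‖h‖ ^ 2) (k : H) :
    ‖star E k‖ ^ 2 ≤ C * RCLike.re ⟪k, N k⟫_ℂ := by
  have re_nonneg : 0 ≤ RCLike.re ⟪k, N k⟫_ℂ :=
    ((ContinuousLinearMap.nonneg_iff_isPositive N).mp hN.nonneg).re_inner_nonneg_right k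
  have inner_eq : ⟪k, E (star E k)⟫_ℂ = ((‖star E k‖ ^ 2 : ℝ) : ℂ) := by
    rw [← ContinuousLinearMap.adjoint_inner_left, ← ContinuousLinearMap.star_eq_adjoint,
      Complex.ofReal_pow]
    exact inner_self_eq_norm_sq_to_K _
  apply le_of_sq_le_mul_self (by positivity)
  calc (‖star E k‖ ^ 2) ^ 2 = ‖⟪k, E (star E k)⟫_ℂ‖ ^ 2 := by simp [inner_eq]
    _ ≤ (C * ‖star E k‖ ^ 2) * RCLike.re ⟪k, N k⟫_ℂ := hE.norm_inner_sq_le fun e he =>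
        (hN.norm_inner_sq_le k (e ⊗ₜ star E k)).trans <| by
          gcongr
          exact ht e he _
    _ = C * RCLike.re ⟪k, N k⟫_ℂ * ‖star E k‖ ^ 2 := by ring

end Evaluation

section MatrixForm

open scoped InnerProductSpace ComplexOrder

variable {H : Type*} [NormedAddCommGroup H] [InnerProductSpace ℂ H] [CompleteSpace H]
  {M : VonNeumannAlgebra H} {A : Type*} [NonUnitalCStarAlgebra A]

/-- The kernel `(b, k, h) ↦ ⟪k, θ(b) h⟫` of an operator-valued map `θ`. -/
def operatorForm (θ : A →ₗ[ℂ] M) : A →ₗ[ℂ] H →ₗ⋆[ℂ] H →ₗ[ℂ] ℂ where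
  toFun b := LinearMap.mk₂'ₛₗ (starRingEnd ℂ) (RingHom.id ℂ)
    (fun k h => ⟪k, (θ b : H →L[ℂ] H) h⟫_ℂ)
    (by simp) (by simp [mul_comm]) (by simp) (by simp)
  map_add' a b := LinearMap.ext₂ fun k h => by simp
  map_smul' c a := LinearMap.ext₂ fun k h => by
    rw [map_smul]
    exact inner_smul_right _ _ _

@[simp]
theorem operatorForm_apply (θ : A →ₗ[ℂ] M) (b : A) (k h : H) :
    operatorForm θ b k h = ⟪k, (θ b : H →L[ℂ] H) h⟫_ℂ := rfl

theorem operatorForm_apply_of_mem_commutant (θ : A →ₗ[ℂ] M) {x : H →L[ℂ] H}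
    (hx : x ∈ M.commutant) (b : A) (k h : H) :
    operatorForm θ b (x k) h = operatorForm θ b k (star x h) := by
  have commute := congrArg (· h) (commute_of_mem_commutant (θ b).2 (star_mem hx))
  rw [operatorForm_apply, operatorForm_apply, ← ContinuousLinearMap.adjoint_inner_right,
    ← ContinuousLinearMap.star_eq_adjoint]
  exact congrArg (⟪k, ·⟫_ℂ) commute

variable {n : Type*} [Fintype n]

/-- The kernel `(b, k, h) ↦ ∑ p, ∑ q, ⟪k p, Ψ(b) p q (h q)⟫` of a map `Ψ` with values in matrices
of operators. -/
def matrixForm (Ψ : A →ₗ[ℂ] CStarMatrix n n M) : A →ₗ[ℂ] (n → H) →ₗ⋆[ℂ] (n → H) →ₗ[ℂ] ℂ where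
  toFun b := LinearMap.mk₂'ₛₗ (starRingEnd ℂ) (RingHom.id ℂ)
    (fun k h => ∑ p, ∑ q, ⟪k p, (Ψ b p q : H →L[ℂ] H) (h q)⟫_ℂ)
    (by intros; simp [Finset.sum_add_distrib])
    (by intros; simp [Finset.sum_mul, mul_comm])
    (by intros; simp [Finset.sum_add_distrib]) (by intros; simp [Finset.mul_sum])
  map_add' a b := LinearMap.ext₂ fun k h => by simp [Finset.sum_add_distrib]
  map_smul' c a := LinearMap.ext₂ fun k h => by
    simp only [map_smul, LinearMap.mk₂'ₛₗ_apply, RingHom.id_apply, LinearMap.smul_apply,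
      smul_eq_mul, Finset.mul_sum]
    exact Finset.sum_congr rfl fun p _ => Finset.sum_congr rfl fun q _ => inner_smul_right _ _ _

@[simp]
theorem matrixForm_apply (Ψ : A →ₗ[ℂ] CStarMatrix n n M) (b : A) (k h : n → H) :
    matrixForm Ψ b k h = ∑ p, ∑ q, ⟪k p, (Ψ b p q : H →L[ℂ] H) (h q)⟫_ℂ := rfl

theorem matrixForm_single [DecidableEq n] (Ψ : A →ₗ[ℂ] CStarMatrix n n M) (b : A) (p q : n)
    (k h : H) :
    matrixForm Ψ b (Pi.single p k) (Pi.single q h) = ⟪k, (Ψ b p q : H →L[ℂ] H) h⟫_ℂ := by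
  rw [matrixForm_apply, Finset.sum_eq_single p (by simp +contextual) (by simp),
    Finset.sum_eq_single q (by simp +contextual) (by simp), Pi.single_eq_same,
    Pi.single_eq_same]

variable [PartialOrder A] [StarOrderedRing A]

theorem kernelForm_matrixForm_isNonneg (Ψ : A →CP CStarMatrix n n M) :
    (kernelForm (matrixForm Ψ.toLinearMap)).IsNonneg := by
  refine kernelForm_isNonneg fun m b h => ?_
  obtain ⟨Y, hY⟩ := completelyPositiveMap_exists_eq_sum_of_family Ψ b
  have entry_eq (i j : Fin m × n) : (Ψ (star (b i.1) * b j.1) i.2 j.2 : H →L[ℂ] H) =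
      ∑ k : Fin m × n, star (Y k.1 i.1 k.2 i.2 : H →L[ℂ] H) * Y k.1 j.1 k.2 j.2 := by
    rw [hY, cstarMatrix_sum_apply, Fintype.sum_prod_type, AddSubmonoidClass.coe_finsetSum]
    refine Finset.sum_congr rfl fun k _ => ?_
    rw [CStarMatrix.mul_apply, AddSubmonoidClass.coe_finsetSum]
    rfl
  refine (sum_inner_nonneg entry_eq fun i => h i.1 i.2).trans_eq ?_
  simp only [Fintype.sum_prod_type]
  refine Finset.sum_congr rfl fun i _ => ?_
  rw [Finset.sum_comm]
  rfl

theorem kernelForm_operatorForm_isNonneg (θ : A →CP M) :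
    (kernelForm (operatorForm θ.toLinearMap)).IsNonneg := by
  refine kernelForm_isNonneg fun m b h => ?_
  obtain ⟨Y, hY⟩ := completelyPositiveMap_exists_eq_sum_of_family θ b
  refine sum_inner_nonneg (Y := fun k i => (Y k i : H →L[ℂ] H))
    (T := fun i j => (θ (star (b i) * b j) : H →L[ℂ] H)) (fun i j => ?_) h
  rw [hY, AddSubmonoidClass.coe_finsetSum]
  rfl

/-- Cauchy–Schwarz for the form of `Ψ`, applied to a vector of its second summand and a vector of
its first summand. -/
theorem norm_inner_evalTensor_sq_le {φ : A →ₙₐ[ℂ] M} {φ₁ : A →CP M}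
    {Ψ : A →CP CStarMatrix (Fin 2) (Fin 2) M} (h₀₀ : ∀ a, Ψ a 0 0 = φ₁ a)
    (h₁₀ : ∀ a, Ψ a 1 0 = φ a) (e : A) (g : H) (ξ : A ⊗[ℂ] H) :
    ‖⟪g, toRepresentation φ e (evalTensor (toRepresentation φ : A →ₗ[ℂ] H →L[ℂ] H) ξ)⟫_ℂ‖ ^ 2 ≤
      (⟪g, (Ψ (e * star e) 1 1 : H →L[ℂ] H) g⟫_ℂ).re *
        (kernelForm (operatorForm φ₁.toLinearMap) ξ ξ).re := by
  let r := kernelForm (matrixForm Ψ.toLinearMap)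
  let j := LinearMap.lTensor A (LinearMap.single ℂ (fun _ : Fin 2 => H) 0)
  have form_first : r (j ξ) (j ξ) = kernelForm (operatorForm φ₁.toLinearMap) ξ ξ := by
    refine (kernelForm_lTensor (t' := operatorForm φ₁.toLinearMap)
      (w := LinearMap.id) (fun b k h => ?_) ξ ξ).trans (by simp)
    exact (matrixForm_single _ b 0 0 k h).trans (congrArg (fun x : M => ⟪k, x.1 h⟫_ℂ) (h₀₀ b))
  have form_second : r (star e ⊗ₜ Pi.single 1 g) (star e ⊗ₜ Pi.single 1 g) =
      ⟪g, (Ψ (e * star e) 1 1 : H →L[ℂ] H) g⟫_ℂ := by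
    rw [kernelForm_tmul, matrixForm_single, star_star]
    rfl
  have form_mixed : r (star e ⊗ₜ Pi.single 1 g) (j ξ) =
      ⟪g, evalTensor (toRepresentation φ : A →ₗ[ℂ] H →L[ℂ] H) (leftMul H e ξ)⟫_ℂ := by
    suffices r (star e ⊗ₜ Pi.single 1 g) ∘ₗ j = (innerSL ℂ g : H →ₗ[ℂ] ℂ) ∘ₗ
        evalTensor (toRepresentation φ : A →ₗ[ℂ] H →L[ℂ] H) ∘ₗ leftMul H e from
      LinearMap.congr_fun this ξ
    refine TensorProduct.ext' fun a h => ?_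
    rw [LinearMap.comp_apply, LinearMap.lTensor_tmul, LinearMap.coe_single, kernelForm_tmul,
      matrixForm_single, star_star]
    exact congrArg (fun x : M => ⟪g, x.1 h⟫_ℂ) (h₁₀ (e * a))
  rw [← evalTensor_leftMul, ← form_mixed, ← form_second, ← form_first]
  exact norm_apply_sq_le_of_isNonneg (kernelForm_matrixForm_isNonneg Ψ) _ _

theorem isSimilarToStarHom_of_matrix {φ : A →ₙₐ[ℂ] M} {C : ℝ} (hφ : ∀ a, ‖φ a‖ ≤ C * ‖a‖)
    {φ₁ : A →CP M} {Ψ : A →CP CStarMatrix (Fin 2) (Fin 2) M} (h₀₀ : ∀ a, Ψ a 0 0 = φ₁ a)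
    (h₁₀ : ∀ a, Ψ a 1 0 = φ a) : IsSimilarToStarHom φ := by
  obtain ⟨l, E, hE⟩ := exists_isSupport (φ := toRepresentation φ) hφ
  obtain ⟨C₁, hC₁, norm_φ₁_le⟩ := completelyPositiveMap_exists_norm_le φ₁
  obtain ⟨C₂, hC₂, norm_Ψ_le⟩ := completelyPositiveMap_exists_norm_le Ψ
  have norm_le {f : A → ℝ} {c : ℝ} (hc : 0 ≤ c) (hf : ∀ a, f a ≤ c * ‖a‖) {e e' : A}
      (he : ‖e‖ ≤ 1) (he' : ‖e'‖ ≤ 1) : f (e * e') ≤ c :=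
    (hf _).trans (mul_le_of_le_one_right hc ((norm_mul_le e e').trans
      (mul_le_one₀ he (norm_nonneg _) he')))
  have form_nonneg := kernelForm_operatorForm_isNonneg φ₁
  have dominated (ξ : A ⊗[ℂ] H) :
      ‖evalTensor (toRepresentation φ : A →ₗ[ℂ] H →L[ℂ] H) ξ‖ ^ 2 ≤
        C₂ * (kernelForm (operatorForm φ₁.toLinearMap) ξ ξ).re := by
    have re_nonneg := (Complex.nonneg_iff.mp (form_nonneg.nonneg ξ)).1
    refine hE.norm_evalTensor_sq_le (by positivity) fun e he g => ?_
    refine (norm_inner_evalTensor_sq_le h₀₀ h₁₀ e g ξ).trans ?_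
    rw [mul_right_comm]
    gcongr
    exact re_inner_apply_self_le (norm_le hC₂ (fun a =>
      CStarMatrix.norm_entry_le_norm.trans (norm_Ψ_le a)) he ((norm_star e).trans_le he)) g
  obtain ⟨N, hN⟩ := exists_isPushforward form_nonneg _ hC₂ dominated
  refine isSimilarToStarHom_of_intertwining hE (c := (C₁ + 1)⁻¹) (by positivity)
    (smul_mul_star_self_le hN.nonneg fun k => ?_)
    (hN.map_mul_eq_mul_star form_nonneg (kernelForm_leftMul _)) fun a x hx => ?_
  · rw [inv_mul_le_iff₀ (by positivity)]
    refine hN.norm_star_support_sq_le hE (by positivity) (fun e he h => ?_) k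
    exact re_inner_apply_self_le ((norm_le hC₁ norm_φ₁_le ((norm_star e).trans_le he) he).trans
      (le_add_of_nonneg_right zero_le_one)) h
  · rw [hN.commute_of_mem (fun x hx => operatorForm_apply_of_mem_commutant _ hx)
      (fun x hx a => commute_of_mem_commutant (φ a).2 hx) hx, sub_self, mul_zero]

end MatrixForm

/-! ### Linear functionals dominating a cone -/

section DominatingFunctional

variable {V : Type*} [AddCommGroup V] [Module ℝ V]

theorem exists_linearMap_forall_snd_le (P : PointedCone ℝ (V × ℝ))
    (hneg : ∀ x ∈ P, ∃ t, (-x.1, t) ∈ P) (hP : ∀ t, (0, t) ∈ P → t ≤ 0) :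
    ∃ f : V →ₗ[ℝ] ℝ, ∀ x ∈ P, x.2 ≤ f x.1 := by
  let W : Submodule ℝ V :=
    { carrier := {v | ∃ t, (v, t) ∈ P}
      zero_mem' := ⟨0, P.zero_mem⟩
      add_mem' := fun ⟨t, ht⟩ ⟨u, hu⟩ => ⟨t + u, P.add_mem ht hu⟩
      smul_mem' := fun c v ⟨t, ht⟩ => by
        rcases le_total 0 c with hc | hc
        · exact ⟨_, P.smul_mem hc ht⟩
        · obtain ⟨u, hu⟩ := hneg _ ht
          refine ⟨-c * u, ?_⟩
          simpa using P.smul_mem (neg_nonneg.mpr hc) hu }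
  let s : PointedCone ℝ (W × ℝ) := P.comap (W.subtype.prodMap (-LinearMap.id))
  have mem_s (w : W) (r : ℝ) : (w, r) ∈ s ↔ ((w : V), -r) ∈ P := Iff.rfl
  let snd : (W × ℝ) →ₗ.[ℝ] ℝ :=
    { domain := (⊥ : Submodule ℝ W).prod ⊤
      toFun := LinearMap.snd ℝ W ℝ ∘ₗ Submodule.subtype _ }
  have snd_nonneg : ∀ x : snd.domain, (x : W × ℝ) ∈ s → 0 ≤ snd x := by
    rintro ⟨⟨w, r⟩, hw⟩ hx
    have w_eq : w = 0 := hw.1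
    subst w_eq
    exact neg_nonpos.mp (hP _ ((mem_s 0 r).mp hx))
  have exists_add_mem (y : W × ℝ) : ∃ x : snd.domain, (x : W × ℝ) + y ∈ s := by
    obtain ⟨⟨w, t, ht⟩, r⟩ := y
    refine ⟨⟨(0, -t - r), ⟨rfl, trivial⟩⟩, (mem_s _ _).mpr ?_⟩
    simpa using ht
  obtain ⟨g, hg, hgs⟩ := riesz_extension s snd snd_nonneg exists_add_mem
  obtain ⟨f, hf⟩ := LinearMap.exists_extend (g ∘ₗ LinearMap.inl ℝ W ℝ)
  refine ⟨f, fun ⟨v, t⟩ hvt => ?_⟩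
  have f_eq : f v = g (⟨v, t, hvt⟩, 0) := LinearMap.congr_fun hf ⟨v, t, hvt⟩
  have g_snd : g (0, -t) = -t := hg ⟨(0, -t), ⟨rfl, trivial⟩⟩
  have g_nonneg : 0 ≤ g (⟨v, t, hvt⟩, -t) := hgs _ ((mem_s _ _).mpr (by rwa [neg_neg]))
  rw [← add_zero (⟨v, t, hvt⟩ : W), ← zero_add (-t), ← Prod.mk_add_mk, map_add, g_snd,
    ← f_eq] at g_nonneg
  linarith

theorem exists_eq_sum_of_mem_hull_range {α : Type*} {g : α → V}
    (hg : ∀ c : ℝ, 0 ≤ c → ∀ a, ∃ a', g a' = c • g a) {x : V}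
    (hx : x ∈ PointedCone.hull ℝ (Set.range g)) :
    ∃ (n : ℕ) (a : Fin n → α), x = ∑ i, g (a i) := by
  obtain ⟨n, c, y, rfl⟩ := Submodule.mem_span_set'.mp hx
  choose a ha using fun i => (y i).2
  choose a' ha' using fun i => hg (c i) (c i).2 (a i)
  exact ⟨n, a', Finset.sum_congr rfl fun i _ => by rw [ha', ha]; rfl⟩

end DominatingFunctional

/-! ### Completely bounded maps into bounded operators -/

section CompletelyBounded

open scoped InnerProductSpace

theorem norm_map_le_of_fintype {A B : Type*} [NonUnitalCStarAlgebra A] [PartialOrder A]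
    [StarOrderedRing A] [NonUnitalCStarAlgebra B] [PartialOrder B] [StarOrderedRing B]
    {f : A →ₗ[ℂ] B} {C : ℝ}
    (hf : ∀ (n : ℕ) (X : CStarMatrix (Fin n) (Fin n) A), ‖X.map f‖ ≤ C * ‖X‖)
    {n : Type*} [Fintype n] (X : CStarMatrix n n A) : ‖X.map f‖ ≤ C * ‖X‖ := by
  let e := Fintype.equivFin n
  have reindex_map : (CStarMatrix.reindexₐ ℂ A e X).map f =
      CStarMatrix.reindexₐ ℂ B e (X.map f) := (CStarMatrix.mapₗ_reindexₐ f).symm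
  simpa only [reindex_map, StarAlgEquiv.norm_map] using hf _ (CStarMatrix.reindexₐ ℂ A e X)

theorem norm_le_one_of_isIdempotentElem_star_mul_self {A : Type*} [NonUnitalCStarAlgebra A] {x : A}
    (h : IsIdempotentElem (star x * x)) : ‖x‖ ≤ 1 := by
  have norm_sq := CStarRing.norm_star_mul_self (x := star x * x)
  rw [star_mul, star_star, h.eq, CStarRing.norm_star_mul_self] at norm_sq
  by_contra! one_lt
  nlinarith [mul_lt_mul'' one_lt one_lt zero_le_one zero_le_one]

variable {D : Type*} [CStarAlgebra D] [PartialOrder D] [StarOrderedRing D] {κ ι : Type*} [Fintype κ]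
  [Fintype ι]

theorem norm_fromBlocks_le_one [DecidableEq ι] {d : κ → ι → D} {p : ι → D}
    (hd : ∀ i j, ∑ k, star (d k i) * d k j = if i = j then p i else 0)
    (hp : ∀ i, IsIdempotentElem (p i)) :
    ‖(CStarMatrix.ofMatrix (Matrix.fromBlocks 0 (Matrix.of d) 0 0) :
      CStarMatrix (κ ⊕ ι) (κ ⊕ ι) D)‖ ≤ 1 := by
  set X : CStarMatrix (κ ⊕ ι) (κ ⊕ ι) D :=
    CStarMatrix.ofMatrix (Matrix.fromBlocks 0 (Matrix.of d) 0 0)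
  have star_mul_self : star X * X =
      CStarMatrix.ofMatrix (Matrix.fromBlocks 0 0 0 (Matrix.diagonal p)) := by
    ext i j
    rw [CStarMatrix.mul_apply]
    simp only [CStarMatrix.star_apply, Fintype.sum_sum_type]
    rcases i with i | i <;> rcases j with j | j <;> simp [X, hd, Matrix.diagonal_apply]
  refine norm_le_one_of_isIdempotentElem_star_mul_self ?_
  rw [star_mul_self]
  have diagonal_mul_self : Matrix.fromBlocks (0 : Matrix κ κ D) 0 0 (Matrix.diagonal p) *
        Matrix.fromBlocks 0 0 0 (Matrix.diagonal p) =
      Matrix.fromBlocks 0 0 0 (Matrix.diagonal p) := by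
    simp [Matrix.fromBlocks_multiply, (hp _).eq]
  exact congrArg CStarMatrix.ofMatrix diagonal_mul_self

variable {H : Type*} [NormedAddCommGroup H] [InnerProductSpace ℂ H] [CompleteSpace H]

theorem sum_norm_sum_map_apply_sq_le [DecidableEq ι] {Φ : D →ₗ[ℂ] H →L[ℂ] H} {C : ℝ} (hC : 0 ≤ C)
    (hΦ : ∀ (n : ℕ) (X : CStarMatrix (Fin n) (Fin n) D), ‖X.map Φ‖ ≤ C * ‖X‖)
    {d : κ → ι → D} {p : ι → D} (hd : ∀ i j, ∑ k, star (d k i) * d k j = if i = j then p i else 0)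
    (hp : ∀ i, IsIdempotentElem (p i)) (v : ι → H) :
    ∑ k, ‖∑ j, Φ (d k j) (v j)‖ ^ 2 ≤ C ^ 2 * ∑ j, ‖v j‖ ^ 2 := by
  let X : CStarMatrix (κ ⊕ ι) (κ ⊕ ι) D :=
    CStarMatrix.ofMatrix (Matrix.fromBlocks 0 (Matrix.of d) 0 0)
  have norm_map_le : ‖X.map Φ‖ ≤ C :=
    (norm_map_le_of_fintype hΦ X).trans (mul_le_of_le_one_right hC (norm_fromBlocks_le_one hd hp))
  have sum_le : ∑ k, ‖∑ j, Φ (d k j) (v j)‖ ^ 2 ≤ ‖X.map Φ‖ ^ 2 * ∑ j, ‖v j‖ ^ 2 := by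
    simpa [Fintype.sum_sum_type, X] using sum_norm_sq_le_norm_sq_mul (X.map Φ) (Sum.elim 0 v)
  exact sum_le.trans (by gcongr)

end CompletelyBounded

/-! ### Paulsen's domination inequality -/

section Paulsen

open scoped InnerProductSpace

variable {H : Type*} [NormedAddCommGroup H] [InnerProductSpace ℂ H] {κ ι : Type*}

theorem exists_orthonormalBasis_sum_inner_mul_inner_eq_zero {E : Type*} [NormedAddCommGroup E]
    [InnerProductSpace ℂ E] [FiniteDimensional ℂ E] [Fintype ι] (h : ι → E) :
    ∃ e : OrthonormalBasis (Fin (Module.finrank ℂ E)) ℂ E,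
      ∀ i j, i ≠ j → ∑ l, ⟪e j, h l⟫_ℂ * ⟪h l, e i⟫_ℂ = 0 := by
  let ρ : E →ₗ[ℂ] E := ∑ l, (InnerProductSpace.rankOne ℂ (h l) (h l)).toLinearMap
  have ρ_apply (x : E) : ρ x = ∑ l, ⟪h l, x⟫_ℂ • h l := by simp [ρ, LinearMap.sum_apply]
  have isSymmetric : ρ.IsSymmetric := fun x y => by
    simp [ρ_apply, sum_inner, inner_sum, inner_smul_left, inner_smul_right, mul_comm]
  let e := isSymmetric.eigenvectorBasis rfl
  refine ⟨e, fun i j hij => ?_⟩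
  calc ∑ l, ⟪e j, h l⟫_ℂ * ⟪h l, e i⟫_ℂ = ⟪e j, ρ (e i)⟫_ℂ := by
        simp [ρ_apply, mul_comm]
    _ = 0 := by
        rw [isSymmetric.apply_eigenvectorBasis, inner_smul_right,
          e.orthonormal.inner_eq_zero hij.symm, mul_zero]

theorem exists_orthonormal_expansion {D : Type*} [AddCommGroup D] [Module ℂ D] [Finite κ]
    [Fintype ι] (ξ : κ → D ⊗[ℂ] H) (h : ι → H) :
    ∃ (n : ℕ) (e : Fin n → H) (b : κ → Fin n → D), Orthonormal ℂ e ∧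
      (∀ k, ξ k = ∑ j, b k j ⊗ₜ e j) ∧
      (∀ i j, i ≠ j → ∑ l, ⟪e j, h l⟫_ℂ * ⟪h l, e i⟫_ℂ = 0) ∧
      ∀ l, ∑ j, ‖⟪e j, h l⟫_ℂ‖ ^ 2 = ‖h l‖ ^ 2 := by
  obtain ⟨T, T_fg, range_le⟩ :=
    TensorProduct.exists_finite_submodule_right_of_setFinite (Set.range ξ) (Set.finite_range ξ)
  let S := T ⊔ Submodule.span ℂ (Set.range h)
  have : FiniteDimensional ℂ S :=
    Module.Finite.iff_fg.mpr ((Module.Finite.iff_fg.mp T_fg).sup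
      (Submodule.fg_span (Set.finite_range h)))
  have h_mem (l) : h l ∈ S := le_sup_right (a := T) (Submodule.subset_span ⟨l, rfl⟩)
  obtain ⟨e, he⟩ :=
    exists_orthonormalBasis_sum_inner_mul_inner_eq_zero fun l => (⟨h l, h_mem l⟩ : S)
  have exists_coeff (k : κ) : ∃ b : Fin _ → D, ξ k = ∑ j, b j ⊗ₜ (e j : H) := by
    obtain ⟨η, hη⟩ := range_le ⟨k, rfl⟩
    obtain ⟨b, hb⟩ := TensorProduct.eq_repr_basis_right e.toBasis
      (LinearMap.lTensor D (Submodule.inclusion (le_sup_left : T ≤ S)) η)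
    refine ⟨b, ?_⟩
    have := congrArg (LinearMap.lTensor D S.subtype) hb
    rw [← LinearMap.lTensor_comp_apply, Submodule.subtype_comp_inclusion, hη] at this
    simpa [Finsupp.sum_fintype] using this.symm
  choose b hb using exists_coeff
  exact ⟨_, fun j => (e j : H), b, e.orthonormal.comp_linearIsometry S.subtypeₗᵢ, hb, he,
    fun l => e.sum_sq_norm_inner_right (⟨h l, h_mem l⟩ : S)⟩

variable {D : Type*} [CStarAlgebra D]

/-- The kernel `(b, k, h) ↦ b ⊗ |h⟩⟨k|`. -/
def rankOneKernel (D H : Type*) [CStarAlgebra D] [NormedAddCommGroup H] [InnerProductSpace ℂ H] :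
    D →ₗ[ℂ] H →ₗ⋆[ℂ] H →ₗ[ℂ] D ⊗[ℂ] (H →L[ℂ] H) where
  toFun b := LinearMap.mk₂'ₛₗ (starRingEnd ℂ) (RingHom.id ℂ)
    (fun k h => b ⊗ₜ InnerProductSpace.rankOne ℂ h k)
    (by simp [TensorProduct.tmul_add]) (by simp) (by simp [TensorProduct.tmul_add]) (by simp)
  map_add' a b := LinearMap.ext₂ fun k h => by simp [TensorProduct.add_tmul]
  map_smul' c a := LinearMap.ext₂ fun k h => by simp [TensorProduct.smul_tmul']

@[simp]
theorem rankOneKernel_apply (b : D) (k h : H) :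
    rankOneKernel D H b k h = b ⊗ₜ InnerProductSpace.rankOne ℂ h k := rfl

variable [Fintype κ] [Fintype ι]

theorem sum_star_mul_eq_of_kernelForm_eq {n : Type*} [Fintype n] {e : n → H}
    (he : Orthonormal ℂ e) {b : κ → n → D} {h : ι → H}
    (heq : ∑ k, kernelForm (rankOneKernel D H) (∑ j, b k j ⊗ₜ e j) (∑ j, b k j ⊗ₜ e j) =
      ∑ l, kernelForm (rankOneKernel D H) (1 ⊗ₜ h l) (1 ⊗ₜ h l)) (i j : n) :
    ∑ k, star (b k i) * b k j = (∑ l, ⟪e j, h l⟫_ℂ * ⟪h l, e i⟫_ℂ) • (1 : D) := by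
  classical
  let coeff : D ⊗[ℂ] (H →L[ℂ] H) →ₗ[ℂ] D := TensorProduct.lift <| LinearMap.mk₂ ℂ
    (fun a T => ⟪e j, T (e i)⟫_ℂ • a) (by simp) (fun c a T => smul_comm _ _ _)
    (by simp [add_smul]) (by simp [mul_smul])
  have coeff_tmul (a T) : coeff (a ⊗ₜ T) = ⟪e j, T (e i)⟫_ℂ • a := rfl
  have coeff_left (k) : coeff (kernelForm (rankOneKernel D H) (∑ j, b k j ⊗ₜ e j)
      (∑ j, b k j ⊗ₜ e j)) = star (b k i) * b k j := by
    simp only [map_sum, LinearMap.sum_apply, kernelForm_tmul, rankOneKernel_apply, coeff_tmul,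
      InnerProductSpace.rankOne_apply, inner_smul_right, orthonormal_iff_ite.mp he]
    simp
  have coeff_right (l) : coeff (kernelForm (rankOneKernel D H) (1 ⊗ₜ h l) (1 ⊗ₜ h l)) =
      (⟪e j, h l⟫_ℂ * ⟪h l, e i⟫_ℂ) • (1 : D) := by
    simp [coeff_tmul, mul_comm]
  have coeff_eq := congrArg coeff heq
  rw [map_sum, map_sum] at coeff_eq
  simpa only [coeff_left, coeff_right, ← Finset.sum_smul] using coeff_eq

variable [PartialOrder D] [StarOrderedRing D]

theorem exists_normalized_coefficients {n : Type*} [DecidableEq n] {b : κ → n → D} {μ : n → ℝ}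
    (hμ : ∀ i, 0 ≤ μ i)
    (hb : ∀ i j, ∑ k, star (b k i) * b k j = if i = j then (μ i : ℂ) • (1 : D) else 0) :
    ∃ d : κ → n → D, (∀ k j, b k j = ((√(μ j) : ℝ) : ℂ) • d k j) ∧
      ∀ i j, ∑ k, star (d k i) * d k j = if i = j then (if μ i = 0 then 0 else 1) else 0 := by
  have eq_zero (k i) (hi : μ i = 0) : b k i = 0 := by
    have sum_eq_zero := hb i i
    rw [if_pos rfl, hi, Complex.ofReal_zero, zero_smul] at sum_eq_zero
    exact (CStarRing.star_mul_self_eq_zero_iff _).mp ((Finset.sum_eq_zero_iff_of_nonneg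
      fun k _ => star_mul_self_nonneg (b k i)).mp sum_eq_zero k (Finset.mem_univ k))
  refine ⟨fun k j => (((√(μ j))⁻¹ : ℝ) : ℂ) • b k j, fun k j => ?_, fun i j => ?_⟩
  · by_cases hj : μ j = 0
    · simp [eq_zero k j hj]
    · rw [smul_smul, ← Complex.ofReal_mul,
        mul_inv_cancel₀ ((Real.sqrt_ne_zero (hμ j)).mpr hj), Complex.ofReal_one, one_smul]
  · have star_mul (k) : star ((((√(μ i))⁻¹ : ℝ) : ℂ) • b k i) * ((((√(μ j))⁻¹ : ℝ) : ℂ) • b k j) =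
        ((((√(μ i))⁻¹ * (√(μ j))⁻¹ : ℝ)) : ℂ) • (star (b k i) * b k j) := by
      simp only [star_smul, smul_mul_smul_comm]
      simp
    simp only [star_mul, ← Finset.smul_sum, hb]
    by_cases hij : i = j
    · subst hij
      by_cases hi : μ i = 0
      · simp [hi]
      · rw [if_pos rfl, if_pos rfl, if_neg hi, smul_smul, ← Complex.ofReal_mul, ← mul_inv,
          Real.mul_self_sqrt (hμ i), inv_mul_cancel₀ hi, Complex.ofReal_one, one_smul]
    · simp [hij]

theorem sum_norm_evalTensor_sq_le [CompleteSpace H] {Φ : D →ₗ[ℂ] H →L[ℂ] H} {C : ℝ} (hC : 0 ≤ C)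
    (hΦ : ∀ (n : ℕ) (X : CStarMatrix (Fin n) (Fin n) D), ‖X.map Φ‖ ≤ C * ‖X‖)
    {ξ : κ → D ⊗[ℂ] H} {h : ι → H} (heq : ∑ k, kernelForm (rankOneKernel D H) (ξ k) (ξ k) =
      ∑ l, kernelForm (rankOneKernel D H) (1 ⊗ₜ h l) (1 ⊗ₜ h l)) :
    ∑ k, ‖evalTensor Φ (ξ k)‖ ^ 2 ≤ C ^ 2 * ∑ l, ‖h l‖ ^ 2 := by
  classical
  obtain ⟨n, e, b, he, hξ, inner_eq_zero, sum_norm_inner⟩ := exists_orthonormal_expansion ξ h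
  let μ (i : Fin n) : ℝ := ∑ l, ‖⟪e i, h l⟫_ℂ‖ ^ 2
  have hμ (i) : 0 ≤ μ i := by positivity
  simp only [hξ] at heq
  have sum_star_mul (i j) :
      ∑ k, star (b k i) * b k j = if i = j then (μ i : ℂ) • (1 : D) else 0 := by
    rw [sum_star_mul_eq_of_kernelForm_eq he heq]
    split_ifs with hij
    · subst hij
      push_cast [μ]
      congr! with l
      rw [← inner_conj_symm (h l) (e i)]
      exact RCLike.mul_conj _
    · rw [inner_eq_zero i j hij, zero_smul]
  obtain ⟨d, b_eq, hd⟩ := exists_normalized_coefficients hμ sum_star_mul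
  have evalTensor_eq (k) :
      evalTensor Φ (ξ k) = ∑ j, Φ (d k j) (((√(μ j) : ℝ) : ℂ) • e j) := by
    simp [hξ k, b_eq]
  have norm_sq (j) : ‖((√(μ j) : ℝ) : ℂ) • e j‖ ^ 2 = μ j := by
    rw [norm_smul, he.1 j, mul_one, Complex.norm_real, Real.norm_eq_abs, sq_abs,
      Real.sq_sqrt (hμ j)]
  calc ∑ k, ‖evalTensor Φ (ξ k)‖ ^ 2 ≤ C ^ 2 * ∑ j, μ j := by
        simpa only [evalTensor_eq, norm_sq] using
          sum_norm_sum_map_apply_sq_le hC hΦ hd (fun i => by split_ifs <;> simp [IsIdempotentElem])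
            fun j => ((√(μ j) : ℝ) : ℂ) • e j
    _ = C ^ 2 * ∑ l, ‖h l‖ ^ 2 := by
        simp only [← sum_norm_inner, μ]
        rw [Finset.sum_comm]

end Paulsen

/-! ### Paulsen's theorem -/

section DominationCone

open scoped InnerProductSpace ComplexOrder

variable {F V : Type*} [AddCommGroup F] [Module ℂ F] [AddCommGroup V] [Module ℂ V]

theorem apply_sqrt_smul_self (s : F →ₗ⋆[ℂ] F →ₗ[ℂ] V) {c : ℝ} (hc : 0 ≤ c) (ξ : F) :
    s (((√c : ℝ) : ℂ) • ξ) (((√c : ℝ) : ℂ) • ξ) = c • s ξ ξ := by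
  rw [map_smul, map_smulₛₗ, LinearMap.smul_apply, Complex.conj_ofReal, smul_smul,
    ← Complex.ofReal_mul, Real.mul_self_sqrt hc, Complex.coe_smul]

theorem norm_sqrt_smul_sq {H : Type*} [SeminormedAddCommGroup H] [NormedSpace ℂ H] {c : ℝ}
    (hc : 0 ≤ c) (x : H) : ‖((√c : ℝ) : ℂ) • x‖ ^ 2 = c * ‖x‖ ^ 2 := by
  rw [norm_smul, mul_pow, Complex.norm_real, Real.norm_eq_abs, sq_abs, Real.sq_sqrt hc]

variable {D H : Type*} [CStarAlgebra D] [NormedAddCommGroup H] [InnerProductSpace ℂ H]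

/-- The cone of the inequalities required of a functional `f` on `D ⊗ B(H)`, where `(v, r)` stands
for `r ≤ f v`: the form `(ξ, η) ↦ f (kernelForm (rankOneKernel D H) ξ η)` is to dominate the
evaluation map of `Φ` and to be bounded by `C ^ 2 * ‖h‖ ^ 2` at `1 ⊗ h`. -/
def dominationCone (Φ : D →ₗ[ℂ] H →L[ℂ] H) (C : ℝ) :
    PointedCone ℝ ((D ⊗[ℂ] (H →L[ℂ] H)) × ℝ) :=
  PointedCone.hull ℝ (Set.range fun ξ =>
      (kernelForm (rankOneKernel D H) ξ ξ, ‖evalTensor Φ ξ‖ ^ 2)) ⊔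
    PointedCone.hull ℝ (Set.range fun h =>
      (-kernelForm (rankOneKernel D H) (1 ⊗ₜ h) (1 ⊗ₜ h), -(C ^ 2 * ‖h‖ ^ 2)))

variable {Φ : D →ₗ[ℂ] H →L[ℂ] H} {C : ℝ}

theorem kernelForm_mem_dominationCone (ξ : D ⊗[ℂ] H) :
    (kernelForm (rankOneKernel D H) ξ ξ, ‖evalTensor Φ ξ‖ ^ 2) ∈ dominationCone Φ C :=
  (le_sup_left : _ ≤ dominationCone Φ C) (PointedCone.subset_hull ⟨ξ, rfl⟩)

theorem neg_kernelForm_one_tmul_mem_dominationCone (h : H) :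
    (-kernelForm (rankOneKernel D H) (1 ⊗ₜ h) (1 ⊗ₜ h), -(C ^ 2 * ‖h‖ ^ 2)) ∈
      dominationCone Φ C :=
  (le_sup_right : _ ≤ dominationCone Φ C) (PointedCone.subset_hull ⟨h, rfl⟩)

theorem exists_eq_of_mem_dominationCone {x : (D ⊗[ℂ] (H →L[ℂ] H)) × ℝ}
    (hx : x ∈ dominationCone Φ C) :
    ∃ (m n : ℕ) (ξ : Fin m → D ⊗[ℂ] H) (h : Fin n → H),
      x.1 = ∑ k, kernelForm (rankOneKernel D H) (ξ k) (ξ k) -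
        ∑ l, kernelForm (rankOneKernel D H) (1 ⊗ₜ h l) (1 ⊗ₜ h l) ∧
      x.2 = ∑ k, ‖evalTensor Φ (ξ k)‖ ^ 2 - C ^ 2 * ∑ l, ‖h l‖ ^ 2 := by
  obtain ⟨y, hy, z, hz, rfl⟩ := Submodule.mem_sup.mp hx
  obtain ⟨m, ξ, rfl⟩ := exists_eq_sum_of_mem_hull_range (fun c hc ξ =>
    ⟨((√c : ℝ) : ℂ) • ξ, by
      rw [apply_sqrt_smul_self _ hc, map_smul, norm_sqrt_smul_sq hc]; rfl⟩) hy
  obtain ⟨n, h, rfl⟩ := exists_eq_sum_of_mem_hull_range (fun c hc h =>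
    ⟨((√c : ℝ) : ℂ) • h, by
      rw [TensorProduct.tmul_smul, apply_sqrt_smul_self _ hc, norm_sqrt_smul_sq hc]
      exact Prod.ext (smul_neg _ _).symm (by simp only [Prod.smul_snd, smul_eq_mul]; ring)⟩) hz
  refine ⟨m, n, ξ, h, ?_, ?_⟩
  · simp [Prod.fst_sum, sub_eq_add_neg]
  · simp [Prod.snd_sum, sub_eq_add_neg, Finset.mul_sum]

variable [PartialOrder D] [StarOrderedRing D]

theorem neg_kernelForm_mem_map_fst (ξ : D ⊗[ℂ] H) :
    -kernelForm (rankOneKernel D H) ξ ξ ∈ (dominationCone Φ C).map (LinearMap.fst ℝ _ ℝ) := by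
  set β := kernelForm (rankOneKernel D H)
  set K := (dominationCone Φ C).map (LinearMap.fst ℝ _ ℝ)
  have kernelForm_mem (ξ) : β ξ ξ ∈ K :=
    PointedCone.mem_map.mpr ⟨_, kernelForm_mem_dominationCone ξ, rfl⟩
  have neg_one_mem (h : H) : -β (1 ⊗ₜ h) (1 ⊗ₜ h) ∈ K :=
    PointedCone.mem_map.mpr ⟨_, neg_kernelForm_one_tmul_mem_dominationCone h, rfl⟩
  induction ξ using TensorProduct.induction_on with
  | zero => simp
  | tmul b h =>
    obtain ⟨c, hc⟩ := exists_eq_star_mul_self_of_nonneg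
      (sub_nonneg.mpr (star_mul_self_le_norm_sq_smul_one b))
    convert K.add_mem (kernelForm_mem (c ⊗ₜ h))
      (K.smul_mem (by positivity : 0 ≤ ‖b‖ ^ 2) (neg_one_mem h)) using 1
    simp only [β, kernelForm_tmul, rankOneKernel_apply, ← hc, TensorProduct.sub_tmul,
      ← TensorProduct.smul_tmul', Complex.coe_smul, star_one, one_mul, smul_neg]
    abel
  | add ξ η hξ hη =>
    -- the parallelogram identity
    convert K.add_mem (kernelForm_mem (ξ - η))
      (K.add_mem (K.smul_mem zero_le_two hξ) (K.smul_mem zero_le_two hη)) using 1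
    simp [two_smul]
    abel

theorem exists_neg_mem_dominationCone {x : (D ⊗[ℂ] (H →L[ℂ] H)) × ℝ}
    (hx : x ∈ dominationCone Φ C) : ∃ t, (-x.1, t) ∈ dominationCone Φ C := by
  have le_comap : dominationCone Φ C ≤
      ((dominationCone Φ C).map (LinearMap.fst ℝ _ ℝ)).comap (-LinearMap.fst ℝ _ ℝ) := by
    refine sup_le (Submodule.span_le.mpr ?_) (Submodule.span_le.mpr ?_)
    · rintro _ ⟨ξ, rfl⟩
      exact neg_kernelForm_mem_map_fst ξ
    · rintro _ ⟨h, rfl⟩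
      exact PointedCone.mem_map.mpr ⟨_, kernelForm_mem_dominationCone (1 ⊗ₜ h), (neg_neg _).symm⟩
  obtain ⟨⟨v, t⟩, ht, hv : v = -x.1⟩ := PointedCone.mem_map.mp (le_comap hx)
  exact ⟨t, hv ▸ ht⟩

theorem snd_nonpos_of_mem_dominationCone [CompleteSpace H] (hC : 0 ≤ C)
    (hΦ : ∀ (n : ℕ) (X : CStarMatrix (Fin n) (Fin n) D), ‖X.map Φ‖ ≤ C * ‖X‖) {t : ℝ}
    (ht : (0, t) ∈ dominationCone Φ C) : t ≤ 0 := by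
  obtain ⟨m, n, ξ, h, fst_eq, snd_eq⟩ := exists_eq_of_mem_dominationCone ht
  exact snd_eq.trans_le
    (sub_nonpos.mpr (sum_norm_evalTensor_sq_le hC hΦ (sub_eq_zero.mp fst_eq.symm)))

theorem exists_dominating_form [CompleteSpace H] (hC : 0 ≤ C)
    (hΦ : ∀ (n : ℕ) (X : CStarMatrix (Fin n) (Fin n) D), ‖X.map Φ‖ ≤ C * ‖X‖) :
    ∃ s : D ⊗[ℂ] H →ₗ⋆[ℂ] D ⊗[ℂ] H →ₗ[ℂ] ℂ, s.IsNonneg ∧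
      (∀ c ξ η, s (leftMul H c ξ) η = s ξ (leftMul H (star c) η)) ∧
      (∀ ξ, ‖evalTensor Φ ξ‖ ^ 2 ≤ (s ξ ξ).re) ∧
      ∀ h, (s (1 ⊗ₜ h) (1 ⊗ₜ h)).re ≤ C ^ 2 * ‖h‖ ^ 2 := by
  obtain ⟨f, hf⟩ := exists_linearMap_forall_snd_le (dominationCone Φ C)
    (fun x hx => exists_neg_mem_dominationCone hx)
    (fun t ht => snd_nonpos_of_mem_dominationCone hC hΦ ht)
  let s := hermitianPart ((kernelForm (rankOneKernel D H)).compr₂ₛₗ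
    (Module.Dual.extendRCLike (𝕜 := ℂ) f))
  have s_self (ξ) : s ξ ξ = (f (kernelForm (rankOneKernel D H) ξ ξ) : ℂ) := by
    rw [hermitianPart_apply_self, LinearMap.compr₂ₛₗ_apply]
    exact congrArg _ (Module.Dual.re_extendRCLike_apply (𝕜 := ℂ) f _)
  have le_s (ξ) : ‖evalTensor Φ ξ‖ ^ 2 ≤ (s ξ ξ).re := by
    rw [s_self, Complex.ofReal_re]
    exact hf _ (kernelForm_mem_dominationCone ξ)
  refine ⟨s, ⟨fun ξ => ?_⟩, fun c ξ η => ?_, le_s, fun h => ?_⟩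
  · rw [s_self, Complex.zero_le_real, ← Complex.ofReal_re (f _), ← s_self]
    exact (sq_nonneg _).trans (le_s ξ)
  · have adjoint := kernelForm_leftMul (rankOneKernel D H)
    simp only [s, hermitianPart_apply, LinearMap.compr₂ₛₗ_apply, adjoint, star_star]
  · have neg_le := hf _ (neg_kernelForm_one_tmul_mem_dominationCone h)
    rw [map_neg] at neg_le
    rw [s_self, Complex.ofReal_re]
    exact neg_le_neg_iff.mp neg_le

theorem exists_intertwining_of_norm_map_le [CompleteSpace H] (Φ : D →ₐ[ℂ] H →L[ℂ] H)
    (hC : 0 ≤ C)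
    (hΦ : ∀ (n : ℕ) (X : CStarMatrix (Fin n) (Fin n) D), ‖X.map Φ‖ ≤ C * ‖X‖) :
    ∃ N : H →L[ℂ] H, 0 ≤ N ∧ (∀ b, Φ b * N = N * star (Φ (star b))) ∧
      ∃ c : ℝ, 0 < c ∧ ∀ k, c * ‖k‖ ^ 2 ≤ RCLike.re ⟪k, N k⟫_ℂ := by
  obtain ⟨s, hs, hadj, hle, hone⟩ := exists_dominating_form (Φ := Φ.toLinearMap) hC hΦ
  obtain ⟨N, hN⟩ := exists_isPushforward hs (evalTensor Φ.toLinearMap) zero_le_one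
    (by simpa only [one_mul] using hle)
  refine ⟨N, hN.nonneg,
    IsPushforward.map_mul_eq_mul_star (Φ := (Φ : D →ₙₐ[ℂ] H →L[ℂ] H)) hN hs hadj,
    (C ^ 2 + 1)⁻¹, by positivity, fun k => ?_⟩
  have re_nonneg : 0 ≤ RCLike.re ⟪k, N k⟫_ℂ :=
    ((ContinuousLinearMap.nonneg_iff_isPositive N).mp hN.nonneg).re_inner_nonneg_right k
  rw [inv_mul_le_iff₀ (by positivity)]
  refine le_of_sq_le_mul_self (by positivity) ?_
  calc (‖k‖ ^ 2) ^ 2 = ‖⟪k, evalTensor Φ.toLinearMap (1 ⊗ₜ k)⟫_ℂ‖ ^ 2 := by simp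
    _ ≤ (s (1 ⊗ₜ k) (1 ⊗ₜ k)).re * RCLike.re ⟪k, N k⟫_ℂ := hN.norm_inner_sq_le k _
    _ ≤ (C ^ 2 + 1) * ‖k‖ ^ 2 * RCLike.re ⟪k, N k⟫_ℂ := by
        gcongr
        linarith [hone k, sq_nonneg ‖k‖]
    _ = (C ^ 2 + 1) * RCLike.re ⟪k, N k⟫_ℂ * ‖k‖ ^ 2 := by ring

end DominationCone

/-! ### The unitization of a completely bounded homomorphism -/

theorem IsCompletelyBounded.exists_nonneg {B D : Type*} [NonUnitalCStarAlgebra B] [PartialOrder B]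
    [StarOrderedRing B] [NonUnitalCStarAlgebra D] [PartialOrder D] [StarOrderedRing D]
    {f : B →ₗ[ℂ] D} (hf : IsCompletelyBounded f) :
    ∃ C : ℝ, 0 ≤ C ∧ ∀ (n : ℕ) (X : CStarMatrix (Fin n) (Fin n) B), ‖X.map f‖ ≤ C * ‖X‖ := by
  obtain ⟨C, hC⟩ := hf
  refine ⟨|C|, abs_nonneg C, fun n X => (hC n X).trans ?_⟩
  gcongr
  exact le_abs_self C

section Unitization

variable {B D : Type*} [NonUnitalCStarAlgebra B] [CStarAlgebra D]

/-- The ⋆-homomorphism `c + b ↦ c` of the unitization of `B` into the unital C⋆-algebra `D`. -/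
def scalarPart (B D : Type*) [NonUnitalCStarAlgebra B] [CStarAlgebra D] :
    Unitization ℂ B →⋆ₙₐ[ℂ] D :=
  (Unitization.starLift (0 : B →⋆ₙₐ[ℂ] D)).toNonUnitalStarAlgHom

theorem scalarPart_apply (x : Unitization ℂ B) : scalarPart B D x = algebraMap ℂ D x.fst :=
  add_zero _

variable [PartialOrder B] [StarOrderedRing B]
  [PartialOrder (Unitization ℂ B)] [StarOrderedRing (Unitization ℂ B)]
  {n : Type*} [Fintype n]

theorem norm_map_snd_le (X : CStarMatrix n n (Unitization ℂ B)) :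
    ‖X.map fun x => x.snd‖ ≤ 2 * ‖X‖ := by
  have map_inr : CStarMatrix.mapₙₐ (Unitization.inrNonUnitalStarAlgHom ℂ B)
      (X.map fun x => x.snd) = X - CStarMatrix.mapₙₐ (scalarPart B (Unitization ℂ B)) X := by
    refine CStarMatrix.ext fun i j => ?_
    change ((X i j).snd : Unitization ℂ B) = X i j - scalarPart B (Unitization ℂ B) (X i j)
    rw [scalarPart_apply, eq_sub_iff_add_eq, add_comm]
    exact Unitization.inl_fst_add_inr_snd_eq _
  calc ‖X.map fun x => x.snd‖
      = ‖CStarMatrix.mapₙₐ (Unitization.inrNonUnitalStarAlgHom ℂ B) (X.map fun x => x.snd)‖ :=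
        (NonUnitalStarAlgHom.norm_map _
          (CStarMatrix.map_injective Unitization.inr_injective) _).symm
    _ ≤ ‖X‖ + ‖CStarMatrix.mapₙₐ (scalarPart B (Unitization ℂ B)) X‖ := by
        rw [map_inr]
        exact norm_sub_le _ _
    _ ≤ ‖X‖ + ‖X‖ := by
        gcongr
        exact NonUnitalStarAlgHom.norm_apply_le (CStarMatrix.mapₙₐ _) X
    _ = 2 * ‖X‖ := (two_mul _).symm

variable [PartialOrder D] [StarOrderedRing D]

theorem IsCompletelyBounded.unitization_lift {Φ : B →ₙₐ[ℂ] D}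
    (hΦ : IsCompletelyBounded (Φ : B →ₗ[ℂ] D)) :
    IsCompletelyBounded (Unitization.lift Φ).toLinearMap := by
  obtain ⟨C, hC, hΦ⟩ := hΦ.exists_nonneg
  refine ⟨C * 2 + 1, fun n X => ?_⟩
  have map_lift : X.map (Unitization.lift Φ).toLinearMap =
      (X.map fun x => x.snd).map (Φ : B →ₗ[ℂ] D) + CStarMatrix.mapₙₐ (scalarPart B D) X := by
    ext i j
    exact (add_comm _ _).trans (congrArg (Φ (X i j).snd + ·) (scalarPart_apply (X i j)).symm)
  calc ‖X.map (Unitization.lift Φ).toLinearMap‖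
      ≤ ‖(X.map fun x => x.snd).map (Φ : B →ₗ[ℂ] D)‖ +
          ‖CStarMatrix.mapₙₐ (scalarPart B D) X‖ := map_lift ▸ norm_add_le _ _
    _ ≤ C * (2 * ‖X‖) + ‖X‖ := by
        gcongr
        · exact (hΦ n _).trans (by gcongr; exact norm_map_snd_le X)
        · exact NonUnitalStarAlgHom.norm_apply_le (CStarMatrix.mapₙₐ _) X
    _ = (C * 2 + 1) * ‖X‖ := by ring

end Unitization

/-! ### Similarities from completely bounded extensions -/

section MaxTensorProduct

open scoped InnerProductSpace

theorem MaxTensorProduct.star_tmul {A B : Type*} [NonUnitalCStarAlgebra A]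
    [NonUnitalCStarAlgebra B] (a : A) (b : B) : star (tmul a b) = tmul (star a) (star b) := by
  rw [tmul, tmul, ← map_star, TensorProduct.star_tmul]

variable {H : Type*} [NormedAddCommGroup H] [InnerProductSpace ℂ H] [CompleteSpace H]

theorem exists_smul_mul_star_self_le {N : H →L[ℂ] H} {c : ℝ} (hN : 0 ≤ N) (hc : 0 < c)
    (h : ∀ k, c * ‖k‖ ^ 2 ≤ RCLike.re ⟪k, N k⟫_ℂ) (E : H →L[ℂ] H) :
    ∃ d : ℝ, 0 < d ∧ d • (E * star E) ≤ N := by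
  refine ⟨c / (‖star E‖ ^ 2 + 1), by positivity, smul_mul_star_self_le hN fun k => ?_⟩
  calc c / (‖star E‖ ^ 2 + 1) * ‖star E k‖ ^ 2
      ≤ c / (‖star E‖ ^ 2 + 1) * (‖star E‖ * ‖k‖) ^ 2 := by
        gcongr
        exact (star E).le_opNorm k
    _ ≤ c / (‖star E‖ ^ 2 + 1) * ((‖star E‖ ^ 2 + 1) * ‖k‖ ^ 2) := by
        rw [mul_pow]
        gcongr
        exact le_add_of_nonneg_right zero_le_one
    _ = c * ‖k‖ ^ 2 := by field_simp
    _ ≤ RCLike.re ⟪k, N k⟫_ℂ := h k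

variable {A : Type*} [NonUnitalCStarAlgebra A] [PartialOrder A] [StarOrderedRing A]
  {M : VonNeumannAlgebra H}

theorem isSimilarToStarHom_of_isCompletelyBounded {φ : A →ₙₐ[ℂ] M} {C : ℝ}
    (hφ : ∀ a, ‖φ a‖ ≤ C * ‖a‖) {Φ : MaxTensorProduct A M.commutant →ₙₐ[ℂ] H →L[ℂ] H}
    (hΦ : IsCompletelyBounded (Φ : MaxTensorProduct A M.commutant →ₗ[ℂ] H →L[ℂ] H))
    (h : ∀ (a : A) (x : M.commutant),
      Φ (MaxTensorProduct.tmul a x) = (φ a : H →L[ℂ] H) * (x : H →L[ℂ] H)) :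
    IsSimilarToStarHom φ := by
  let := CStarAlgebra.spectralOrder (Unitization ℂ (MaxTensorProduct A M.commutant))
  have := CStarAlgebra.spectralOrderedRing (Unitization ℂ (MaxTensorProduct A M.commutant))
  obtain ⟨C', hC', norm_le⟩ := hΦ.unitization_lift.exists_nonneg
  obtain ⟨N, hN, hΦN, c, hc, hcN⟩ :=
    exists_intertwining_of_norm_map_le (Unitization.lift Φ) hC' norm_le
  obtain ⟨l, E, hE⟩ := exists_isSupport (φ := toRepresentation φ) hφ
  obtain ⟨d, hd, hdN⟩ := exists_smul_mul_star_self_le hN hc hcN E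
  have mul_mul_eq (a : A) (x : M.commutant) : (φ a : H →L[ℂ] H) * x * N =
      N * (x * star (φ (star a) : H →L[ℂ] H)) := by
    simpa [← Unitization.inr_star, MaxTensorProduct.star_tmul, h] using
      hΦN (MaxTensorProduct.tmul a x : MaxTensorProduct A M.commutant)
  have mul_eq (a : A) : (φ a : H →L[ℂ] H) * N = N * star (φ (star a) : H →L[ℂ] H) := by
    simpa using mul_mul_eq a 1
  refine isSimilarToStarHom_of_intertwining hE hd hdN mul_eq fun a x hx => ?_
  rw [mul_sub, sub_eq_zero, ← mul_assoc, mul_mul_eq a ⟨x, hx⟩, ← mul_assoc (φ a : H →L[ℂ] H),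
    mul_eq, mul_assoc]
  exact congrArg (N * ·) (commute_of_mem_commutant (star_mem (φ (star a)).2) hx)

end MaxTensorProduct

/-! ### The universal property of the maximal tensor product -/

namespace CStarSeminorm

variable {D E : Type*} [NonUnitalRing D] [StarRing D] [Module ℂ D] [NonUnitalCStarAlgebra E]

/-- The C⋆-seminorm `x ↦ ‖σ x‖` of a ⋆-homomorphism `σ` into a C⋆-algebra. -/
def ofStarHom (σ : D →⋆ₙₐ[ℂ] E) : CStarSeminorm D where
  toFun x := ‖σ x‖
  map_zero' := by simp
  add_le' x y := by rw [map_add]; exact norm_add_le _ _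
  neg' x := by rw [map_neg, norm_neg]
  smul' c x := by rw [map_smul, norm_smul]
  mul_le' x y := by rw [map_mul]; exact norm_mul_le _ _
  star_mul_self' x := by rw [map_mul, StarHomClass.map_star]; exact CStarRing.norm_star_mul_self

variable [IsScalarTower ℂ D D] [SMulCommClass ℂ D D] (p : CStarSeminorm D)

theorem exists_lift {σ : D →⋆ₙₐ[ℂ] E} (hσ : ∀ x, ‖σ x‖ ≤ p x) :
    ∃ τ : p.Compl →⋆ₙₐ[ℂ] E, ∀ x, τ (p.incl x) = σ x := by
  let σ₀ : p.Pre →ₗ[ℂ] E :=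
    { toFun := σ, map_add' := map_add σ, map_smul' := map_smul σ }
  let τ : p.Compl →L[ℂ] E := (σ₀.mkContinuous 1 fun x => by
    rw [one_mul]; exact hσ x).fromCompletion
  have τ_incl (x) : τ (p.incl x) = σ x :=
    ContinuousLinearMap.fromCompletion_apply_coe _ (p.toPre x)
  have map_mul (x y : p.Compl) : τ (x * y) = τ x * τ y := by
    refine p.compl_ind (isClosed_eq (by fun_prop) (by fun_prop)) (fun x => ?_) x
    refine p.compl_ind (isClosed_eq (by fun_prop) (by fun_prop)) (fun y => ?_) y
    rw [← incl_mul, τ_incl, τ_incl, τ_incl, _root_.map_mul]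
  have map_star (x : p.Compl) : τ (star x) = star (τ x) := by
    refine p.compl_ind (isClosed_eq (by fun_prop) (by fun_prop)) (fun x => ?_) x
    rw [star_incl, τ_incl, τ_incl, StarHomClass.map_star]
  exact ⟨{ τ.toLinearMap with
    map_zero' := map_zero τ
    map_mul' := map_mul
    map_star' := map_star }, τ_incl⟩

end CStarSeminorm

namespace MaxTensorProduct

variable {A B E : Type*} [NonUnitalCStarAlgebra A] [NonUnitalCStarAlgebra B]
  [NonUnitalCStarAlgebra E]

/-- The ⋆-homomorphism `a ⊗ b ↦ f a * g b` of the algebraic tensor product, where `f` and `g` have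
commuting ranges. -/
def algebraicLift (f : A →⋆ₙₐ[ℂ] E) (g : B →⋆ₙₐ[ℂ] E) (hfg : ∀ a b, Commute (f a) (g b)) :
    A ⊗[ℂ] B →⋆ₙₐ[ℂ] E where
  __ := TensorProduct.lift ((LinearMap.mul ℂ E).compl₁₂ (f : A →ₗ[ℂ] E) (g : B →ₗ[ℂ] E))
  map_zero' := map_zero _
  map_mul' x y := by
    dsimp only [LinearMap.toFun_eq_coe]
    induction x using TensorProduct.induction_on with
    | zero => simp
    | add x x' hx hx' => simp only [add_mul, map_add, hx, hx']
    | tmul a b =>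
      induction y using TensorProduct.induction_on with
      | zero => simp
      | add y y' hy hy' => simp only [mul_add, map_add, hy, hy']
      | tmul a' b' => simpa using (hfg a' b).mul_mul_mul_comm (f a) (g b')
  map_star' x := by
    dsimp only [LinearMap.toFun_eq_coe]
    induction x using TensorProduct.induction_on with
    | zero => simp
    | add x x' hx hx' => simp only [star_add, map_add, hx, hx']
    | tmul a b => simpa [← map_star] using (hfg (star a) (star b)).eq

theorem exists_lift (f : A →⋆ₙₐ[ℂ] E) (g : B →⋆ₙₐ[ℂ] E) (hfg : ∀ a b, Commute (f a) (g b)) :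
    ∃ σ : MaxTensorProduct A B →⋆ₙₐ[ℂ] E, ∀ a b, σ (tmul a b) = f a * g b := by
  obtain ⟨σ, hσ⟩ := (CStarSeminorm.maxTensor A B).exists_lift (σ := algebraicLift f g hfg)
    (CStarSeminorm.le_maxTensor (.ofStarHom (algebraicLift f g hfg)))
  exact ⟨σ, fun a b => hσ (a ⊗ₜ b)⟩

end MaxTensorProduct

/-! ### Completely bounded extensions from similarities -/

section Conjugation

variable {D : Type*} [CStarAlgebra D] {n : Type*} [Fintype n] [DecidableEq n]

/-- The ⋆-homomorphism sending `d` to the diagonal matrix with all diagonal entries equal to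
`d`. -/
def diagonalHom (n D : Type*) [CStarAlgebra D] [Fintype n] [DecidableEq n] :
    D →⋆ₙₐ[ℂ] CStarMatrix n n D where
  toFun d := CStarMatrix.ofMatrix (Matrix.diagonal fun _ => d)
  map_smul' c x := CStarMatrix.ext fun i j => by by_cases h : i = j <;> simp [h]
  map_zero' := CStarMatrix.ext fun i j => by simp
  map_add' x y := CStarMatrix.ext fun i j => by by_cases h : i = j <;> simp [h]
  map_mul' x y := CStarMatrix.ext fun i j => by
    by_cases h : i = j <;> simp [CStarMatrix.mul_apply, Matrix.diagonal_apply, h]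
  map_star' x := CStarMatrix.ext fun i j => by
    by_cases h : i = j <;> simp [CStarMatrix.star_apply, h, eq_comm]

variable [PartialOrder D] [StarOrderedRing D]

theorem norm_diagonalHom_mul_mul_le (c d : D) (X : CStarMatrix n n D) :
    ‖diagonalHom n D c * X * diagonalHom n D d‖ ≤ ‖c‖ * ‖X‖ * ‖d‖ :=
  norm_mul₃_le.trans <| by
    gcongr
    · exact NonUnitalStarAlgHom.norm_apply_le (diagonalHom n D) c
    · exact NonUnitalStarAlgHom.norm_apply_le (diagonalHom n D) d

variable {A : Type*} [NonUnitalCStarAlgebra A] [PartialOrder A] [StarOrderedRing A]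

theorem isCompletelyBounded_conjHom (σ : A →⋆ₙₐ[ℂ] D) (S : Dˣ) :
    IsCompletelyBounded (conjHom (σ : A →ₙₐ[ℂ] D) S : A →ₗ[ℂ] D) := by
  refine ⟨‖(S : D)‖ * ‖((S⁻¹ : Dˣ) : D)‖, fun n X => ?_⟩
  have map_conjHom : X.map (conjHom (σ : A →ₙₐ[ℂ] D) S : A →ₗ[ℂ] D) =
      diagonalHom (Fin n) D S * CStarMatrix.mapₙₐ σ X * diagonalHom (Fin n) D ↑S⁻¹ := by
    ext i j
    simp [CStarMatrix.mul_apply, Matrix.diagonal_apply, diagonalHom, conjHom_apply]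
    rfl
  calc ‖X.map (conjHom (σ : A →ₙₐ[ℂ] D) S : A →ₗ[ℂ] D)‖
      ≤ ‖(S : D)‖ * ‖CStarMatrix.mapₙₐ σ X‖ * ‖((S⁻¹ : Dˣ) : D)‖ :=
        map_conjHom ▸ norm_diagonalHom_mul_mul_le _ _ _
    _ ≤ ‖(S : D)‖ * ‖X‖ * ‖((S⁻¹ : Dˣ) : D)‖ := by
        gcongr
        exact NonUnitalStarAlgHom.norm_apply_le (CStarMatrix.mapₙₐ σ) X
    _ = ‖(S : D)‖ * ‖((S⁻¹ : Dˣ) : D)‖ * ‖X‖ := by ring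

end Conjugation

theorem IsSimilarToStarHom.exists_isCompletelyBounded {A H : Type*} [NonUnitalCStarAlgebra A]
    [NormedAddCommGroup H] [InnerProductSpace ℂ H] [CompleteSpace H] {M : VonNeumannAlgebra H}
    {φ : A →ₙₐ[ℂ] M} (hφ : IsSimilarToStarHom φ) :
    ∃ Φ : MaxTensorProduct A M.commutant →ₙₐ[ℂ] H →L[ℂ] H,
      IsCompletelyBounded (Φ : MaxTensorProduct A M.commutant →ₗ[ℂ] H →L[ℂ] H) ∧
      ∀ (a : A) (x : M.commutant),
        Φ (MaxTensorProduct.tmul a x) = (φ a : H →L[ℂ] H) * (x : H →L[ℂ] H) := by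
  obtain ⟨S, π, hπ⟩ := hφ
  let ι (N : VonNeumannAlgebra H) : N →⋆ₐ[ℂ] H →L[ℂ] H := N.toStarSubalgebra.subtype
  obtain ⟨σ, hσ⟩ := MaxTensorProduct.exists_lift ((ι M : M →⋆ₙₐ[ℂ] H →L[ℂ] H).comp π)
    (ι M.commutant : M.commutant →⋆ₙₐ[ℂ] H →L[ℂ] H)
    fun a x => (commute_of_mem_commutant (π a).2 x.2).symm
  refine ⟨conjHom (σ : MaxTensorProduct A M.commutant →ₙₐ[ℂ] H →L[ℂ] H)
    (Units.map (ι M : M →* H →L[ℂ] H) S⁻¹), isCompletelyBounded_conjHom σ _, fun a x => ?_⟩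
  have φ_eq : ((S⁻¹ : (↥M)ˣ) : M) * π a * (S : M) = φ a := by simp [hπ, ← mul_assoc]
  have conj_eq : conjHom (σ : MaxTensorProduct A M.commutant →ₙₐ[ℂ] H →L[ℂ] H)
      (Units.map (ι M : M →* H →L[ℂ] H) S⁻¹) (MaxTensorProduct.tmul a x) =
      ((S⁻¹ : (↥M)ˣ) : M) * ((π a : H →L[ℂ] H) * x) * (S : M) :=
    congrArg (fun y => _ * y * _) (hσ a x)
  rw [conj_eq, ← φ_eq, mul_assoc, mul_assoc, commute_of_mem_commutant (S : M).2 x.2]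
  simp only [MulMemClass.coe_mul, mul_assoc]

end

theorem mainTheorem6 {A : Type*} [NonUnitalCStarAlgebra A] [PartialOrder A] [StarOrderedRing A]
    {H : Type*} [NormedAddCommGroup H] [InnerProductSpace ℂ H] [CompleteSpace H]
    (M : VonNeumannAlgebra H) (φ : A →ₙₐ[ℂ] M) (hφ : ∃ C : ℝ, ∀ a : A, ‖φ a‖ ≤ C * ‖a‖) :
    List.TFAE [
      -- (1) `φ` is similar in `M` to a ⋆-representation
      ∃ (S : (↥M)ˣ) (π : A →⋆ₙₐ[ℂ] M), ∀ a : A, π a = (S : M) * φ a * ((S⁻¹ : (↥M)ˣ) : M),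
      -- (2) `a ⊗ x ↦ φ(a) x` is a completely bounded representation of `A ⊗_max M'` on `H`
      ∃ Φ : MaxTensorProduct A M.commutant →ₙₐ[ℂ] (H →L[ℂ] H),
        IsCompletelyBounded (Φ : MaxTensorProduct A M.commutant →ₗ[ℂ] (H →L[ℂ] H)) ∧
        ∀ (a : A) (x : M.commutant),
          Φ (MaxTensorProduct.tmul a x) = (φ a : H →L[ℂ] H) * (x : H →L[ℂ] H),
      -- (3) `φ` is a combination of four completely positive maps
      ∃ φ₁ φ₂ φ₃ φ₄ : A →CP M,
        ∀ a : A, φ a = φ₁ a - φ₂ a + Complex.I • (φ₃ a - φ₄ a),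
      -- (4) `φ` has a `2 × 2` completely positive dilation
      ∃ (φ₁ φ₂ : A →CP M) (Ψ : A →CP CStarMatrix (Fin 2) (Fin 2) M),
        ∀ a : A, Ψ a = CStarMatrix.ofMatrix
          !![φ₁ a, star (φ (star a)); φ a, φ₂ a],
      -- (5)
      ∃ (ψ : A →CP M) (T S : M), ∀ a : A, φ a = star T * ψ a * S,
      -- (6)
      ∃ (n : ℕ) (ψ : Fin n → (A →CP M)) (T S : Fin n → M),
        ∀ a : A, φ a = ∑ i, star (T i) * ψ i a * S i,
      -- (7)
      ∃ (n : ℕ) (π : Fin n → (A →⋆ₙₐ[ℂ] M)) (T : Fin n → (↥M)ˣ) (α : Fin n → ℝ),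
        (∀ i, 0 ≤ (T i : M)) ∧ (∀ i, 0 < α i) ∧ ∑ i, α i = 1 ∧
        ∀ a : A, φ a = ∑ i, ((α i : ℝ) : ℂ) • ((T i : M) * π i a * (((T i)⁻¹ : (↥M)ˣ) : M))] := by
  tfae_have 1 → 2 := IsSimilarToStarHom.exists_isCompletelyBounded
  tfae_have 2 → 1 := fun ⟨_, hΦ, h⟩ =>
    isSimilarToStarHom_of_isCompletelyBounded hφ.choose_spec hΦ h
  tfae_have 1 → 5 := IsSimilarToStarHom.exists_eq_star_mul_mul
  tfae_have 5 → 6 := fun ⟨ψ, T, S, h⟩ =>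
    ⟨1, fun _ => ψ, fun _ => T, fun _ => S, fun a => by rw [h, Fin.sum_univ_one]⟩
  tfae_have 6 → 4 := fun ⟨_, _, _, _, h⟩ => exists_matrix_of_eq_sum h
  tfae_have 4 → 3 := fun ⟨_, _, Ψ, hΨ⟩ => by
    obtain ⟨ψ₁, ψ₂, ψ₃, ψ₄, h⟩ := exists_polarization Ψ
    exact ⟨ψ₁, ψ₂, ψ₃, ψ₄, fun a => by rw [← h, hΨ]; rfl⟩
  tfae_have 3 → 6 := fun ⟨φ₁, φ₂, φ₃, φ₄, h⟩ =>
    ⟨4, ![φ₁, φ₂, φ₃, φ₄], ![1, -1, -Complex.I • 1, Complex.I • 1], fun _ => 1, fun a => by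
      rw [h]
      simp [Fin.sum_univ_four, sub_eq_add_neg, add_assoc]⟩
  tfae_have 4 → 1 := fun ⟨_, _, _, hΨ⟩ =>
    isSimilarToStarHom_of_matrix hφ.choose_spec (fun a => by rw [hΨ]; rfl) fun a => by rw [hΨ]; rfl
  tfae_have 1 → 7 := fun h => by
    obtain ⟨T, π, hT, hπ⟩ := IsSimilarToStarHom.exists_eq_conj_nonneg h
    exact ⟨1, fun _ => π, fun _ => T, fun _ => 1, fun _ => hT, fun _ => one_pos, by simp,
      fun a => by simp [hπ]⟩
  tfae_have 7 → 6 := fun ⟨n, π, T, α, _, _, _, h⟩ =>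
    ⟨n, fun i => (π i : A →CP M), fun i => ((α i : ℝ) : ℂ) • star (T i : M),
      fun i => (((T i)⁻¹ : (↥M)ˣ) : M), fun a => by
        simpa [completelyPositiveMap_coe_apply] using h a⟩
  tfae_finish
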